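/- Let $f:\mathbb{R}^d\to\mathbb{R}$ be of class $C^2$, let $x_*$ be a local minimizer of $f$, and suppose that $f$ satisfies the local Polyak–Łojasiewicz condition at $x_*$: there are an open neighbourhood $U$ of $x_*$ and $\nu>0$ with $\|\nabla f(x)\|^2\ge 2\nu\,(f(x)-f(x_*))$ for all $x\in U$ (Euclidean norm). Suppose also that $f$ is not constant on any neighbourhood of $x_*$. Let $\mathcal S$ be the set of local minimizers $x$ of $f$ with $f(x)=f(x_*)$, let $T_{x_*}\mathcal S$ be the set of velocities $c'(0)$ of $C^1$ curves $c:(-\delta,\delta)\to\mathcal S$ with $c(0)=x_*$, and let $N_{x_*}\mathcal S=(T_{x_*}\mathcal S)^\perp$. Then $\nabla^2 f(x_*)$ has a smallest eigenvalue $\mu$ among those with an eigenvector in $N_{x_*}\mathcal S$, and $\mu>0$. For $\gamma>0$ put \[ \rho_\gamma=\frac{\gamma-\sqrt{\max\{0,\gamma^2-4\mu\}}}{2}. \] For every $\gamma>0$ and every $\varepsilon>0$ there is a constant $C_\varepsilon>0$ (depending only on $f$, $x_*$, $\gamma$, $\varepsilon$) such that for every neighbourhood $V$ of $x_*$ there is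 an open neighbourhood $\mathcal U\subset\mathbb{R}^d\times\mathbb{R}^d$ of $(x_*,0)$ with the following property. For every $(x_0,v_0)\in\mathcal U$ the Heavy Ball equation \[ \ddot x(t)+\gamma\dot x(t)+\nabla f(x(t))=0,\qquad x(0)=x_0,\ \dot x(0)=v_0, \] has a solution on $[0,\infty)$, and every such solution converges, as $t\to\infty$, to some $x_*'\in\mathcal S\cap V$, with \[ \|x(t)-x_*'\|\le C_\varepsilon\bigl(\|x(0)-x_*'\|+\|\dot x(0)\|\bigr)e^{-(\rho_\gamma-\varepsilon)t}\qquad\text{for all } t\ge 0 . \] In particular, for $\gamma=2\sqrt\mu$ this holds with $\rho_\gamma=\sqrt\mu$, and this choice is optimal: $\rho_\gamma<\sqrt\mu$ for every $\gamma>0$ with $\gamma\neq 2\sqrt\mu$. -/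

import Mathlib

open Set Filter Topology

/-- The local Polyak–Łojasiewicz condition of `f` at `xs`. -/
def LocalPL {d : ℕ} (f : EuclideanSpace ℝ (Fin d) → ℝ) (xs : EuclideanSpace ℝ (Fin d)) : Prop :=
  ∃ U : Set (EuclideanSpace ℝ (Fin d)), IsOpen U ∧ xs ∈ U ∧
    ∃ ν : ℝ, 0 < ν ∧ ∀ x ∈ U, 2 * ν * (f x - f xs) ≤ ‖gradient f x‖ ^ 2

/-- The local minimizers of `f` at the level of `xs`. -/
def minimizerSet {d : ℕ} (f : EuclideanSpace ℝ (Fin d) → ℝ) (xs : EuclideanSpace ℝ (Fin d)) :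
    Set (EuclideanSpace ℝ (Fin d)) :=
  {x | IsLocalMin f x ∧ f x = f xs}

/-- The Hessian of `f` at `x` as a linear operator: the derivative of the gradient. -/
noncomputable def hessian {d : ℕ} (f : EuclideanSpace ℝ (Fin d) → ℝ)
    (x : EuclideanSpace ℝ (Fin d)) :
    EuclideanSpace ℝ (Fin d) →L[ℝ] EuclideanSpace ℝ (Fin d) :=
  fderiv ℝ (gradient f) x

/-- The vectors tangent to a set `S` at `x`: velocities at time `0` of `C¹` curves
`(-δ, δ) → S` through `x`. (As `δ` may be shrunk, this depends only on `S` near `x`.) -/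
def tangentVectors {d : ℕ} (S : Set (EuclideanSpace ℝ (Fin d)))
    (x : EuclideanSpace ℝ (Fin d)) : Set (EuclideanSpace ℝ (Fin d)) :=
  {w | ∃ (δ : ℝ) (c : ℝ → EuclideanSpace ℝ (Fin d)), 0 < δ ∧
    ContDiffOn ℝ 1 c (Ioo (-δ) δ) ∧ (∀ t ∈ Ioo (-δ) δ, c t ∈ S) ∧ c 0 = x ∧ deriv c 0 = w}

/-- The normal space of `S` at `x`: the orthogonal complement of the tangent vectors. -/
noncomputable def normalSpaceAt {d : ℕ} (S : Set (EuclideanSpace ℝ (Fin d)))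
    (x : EuclideanSpace ℝ (Fin d)) : Submodule ℝ (EuclideanSpace ℝ (Fin d)) :=
  (Submodule.span ℝ (tangentVectors S x))ᗮ

/-- The eigenvalues of the Hessian of `f` at `xs` restricted to the normal space of the set of
minimizers at `xs`. -/
def normalEigenvalues {d : ℕ} (f : EuclideanSpace ℝ (Fin d) → ℝ)
    (xs : EuclideanSpace ℝ (Fin d)) : Set ℝ :=
  {l | ∃ v ∈ normalSpaceAt (minimizerSet f xs) xs, v ≠ 0 ∧ hessian f xs v = l • v}

/-- The constant `μ`: the smallest eigenvalue of the Hessian at `xs` on the normal space. -/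
noncomputable def normalMu {d : ℕ} (f : EuclideanSpace ℝ (Fin d) → ℝ)
    (xs : EuclideanSpace ℝ (Fin d)) : ℝ :=
  sInf (normalEigenvalues f xs)

/-- `x`, with velocity `v`, solves `x'' + γ x' + ∇f(x) = 0` on `[0, ∞)`. -/
def IsHeavyBallTrajectory {d : ℕ} (f : EuclideanSpace ℝ (Fin d) → ℝ) (γ : ℝ)
    (x v : ℝ → EuclideanSpace ℝ (Fin d)) : Prop :=
  ∀ t : ℝ, 0 ≤ t →
    HasDerivWithinAt x (v t) (Ici 0) t ∧
    HasDerivWithinAt v (-(γ • v t) - gradient f (x t)) (Ici 0) t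

/-- The rate `ρ_γ`. -/
noncomputable def heavyBallRate (γ μ : ℝ) : ℝ :=
  (γ - √(max 0 (γ ^ 2 - 4 * μ))) / 2

/-- Local exponential convergence with rate `r` of the heavy ball flow near `(xs, 0)`: with a
constant `C` that does not depend on the initial condition, every trajectory started in some open
neighbourhood of `(xs, 0)` exists for all times and converges to a local minimizer `x'` at the
level of `xs`, with rate `r`; the limit is as close to `xs` as desired once the neighbourhood is
small. -/
def HasLocalExpRate {d : ℕ} (f : EuclideanSpace ℝ (Fin d) → ℝ)
    (xs : EuclideanSpace ℝ (Fin d)) (γ r : ℝ) : Prop :=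
  ∃ C : ℝ, 0 < C ∧ ∀ V ∈ 𝓝 xs,
    ∃ W : Set (EuclideanSpace ℝ (Fin d) × EuclideanSpace ℝ (Fin d)),
      IsOpen W ∧ (xs, 0) ∈ W ∧ ∀ x₀ v₀, (x₀, v₀) ∈ W →
        (∃ x v, IsHeavyBallTrajectory f γ x v ∧ x 0 = x₀ ∧ v 0 = v₀) ∧
        ∀ x v, IsHeavyBallTrajectory f γ x v → x 0 = x₀ → v 0 = v₀ →
          ∃ x' ∈ minimizerSet f xs, x' ∈ V ∧ Tendsto x atTop (𝓝 x') ∧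
            ∀ t : ℝ, 0 ≤ t →
              ‖x t - x'‖ ≤ C * (‖x 0 - x'‖ + ‖v 0‖) * Real.exp (-r * t)

/-! Let `H` be the Hessian at `xs` and `P` the orthogonal projection to `(ker H)ᗮ`. Where `∇f x`
lies in `ker H`, a gradient step lowers `f` so much that the PL inequality forces `f x = f xs`.
Hence, near `xs`, the minimizers are the solutions of `P ∇f = 0`, a `C¹` manifold by the inverse
function theorem, with normal space `(ker H)ᗮ`; there `H` is bounded below by `μ > 0`.

The coordinate `q`, valued in `(ker H)ᗮ` with `H q = P ∇f` and `Dq(xs) = P`, satisfies `∇f = H q +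
o(‖q‖)`: the tangential part of the gradient has zero derivative at `xs` and vanishes on the
minimizers. Along a trajectory, `q' ≈ P v` and `v' ≈ -γ v - H q`, with relative errors that are
small near `xs`.

For `r < ρ_γ` the quadratic `heavyBallEnergy` is coercive and decays at rate `2r` under the linear
system; errors cost an arbitrarily small part of the rate. Thus `q` and the whole velocity decay
exponentially, which traps the trajectory near `xs` and makes it converge to a zero `x'` of `q`.
Finally `‖q (x 0)‖ ≤ 2‖x 0 - x'‖` gives the stated bound. -/

/-! ### Second-order calculus with gradients. -/

section Calculus

variable {E : Type*} [NormedAddCommGroup E] [InnerProductSpace ℝ E] [CompleteSpace E]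

/-- The gradient of a `C²` function is `C¹`. -/
theorem ContDiff.gradient_one {f : E → ℝ} (hf : ContDiff ℝ 2 f) :
    ContDiff ℝ 1 (gradient f) := by
  have h : ContDiff ℝ 1 (fderiv ℝ f) := hf.fderiv_right (by norm_num)
  exact (InnerProductSpace.toDual ℝ E).symm.contDiff.comp h

theorem ContDiff.hasStrictFDerivAt_gradient {f : E → ℝ} (hf : ContDiff ℝ 2 f) (x : E) :
    HasStrictFDerivAt (gradient f) (fderiv ℝ (gradient f) x) x :=
  hf.gradient_one.contDiffAt.hasStrictFDerivAt one_ne_zero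

theorem ContDiff.hasFDerivAt_toDual_gradient {f : E → ℝ} (hf : ContDiff ℝ 2 f) (x : E) :
    HasFDerivAt f (InnerProductSpace.toDual ℝ E (gradient f x)) x :=
  (hf.differentiable (by norm_num) x).hasGradientAt

/-- The derivative of the gradient of a `C²` function is symmetric. -/
theorem inner_fderiv_gradient_comm {f : E → ℝ} (hf : ContDiff ℝ 2 f) (x u w : E) :
    inner ℝ (fderiv ℝ (gradient f) x u) w = inner ℝ u (fderiv ℝ (gradient f) x w) := by
  have h1 : HasFDerivAt (fun y => InnerProductSpace.toDual ℝ E (gradient f y))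
      ((InnerProductSpace.toDual ℝ E).toContinuousLinearEquiv.toContinuousLinearMap ∘L
        fderiv ℝ (gradient f) x) x :=
    ((InnerProductSpace.toDual ℝ E).toContinuousLinearEquiv.toContinuousLinearMap.hasFDerivAt).comp
      x (hf.hasStrictFDerivAt_gradient x).hasFDerivAt
  have h2 := second_derivative_symmetric (fun y => hf.hasFDerivAt_toDual_gradient y) h1 u w
  have h3 : inner ℝ (fderiv ℝ (gradient f) x u) w = inner ℝ (fderiv ℝ (gradient f) x w) u := by
    simpa using h2
  rw [h3, real_inner_comm]

/-- The gradient vanishes at a local minimizer. -/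
theorem IsLocalMin.gradient_eq_zero {f : E → ℝ} {x : E} (h : IsLocalMin f x) :
    gradient f x = 0 := by
  simp [gradient, h.fderiv_eq_zero]

/-- The second order Taylor formula, uniformly near a point. -/
theorem exists_ball_taylor_two {f : E → ℝ} (hf : ContDiff ℝ 2 f) (a : E) {c : ℝ}
    (hc : 0 < c) : ∃ R > 0, ∀ x ∈ Metric.ball a R, ∀ y ∈ Metric.ball a R,
      |f y - f x - inner ℝ (gradient f x) (y - x)
        - inner ℝ (fderiv ℝ (gradient f) a (y - x)) (y - x) / 2| ≤ c * ‖y - x‖ ^ 2 := by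
  set g := gradient f
  set H := fderiv ℝ g a
  have hs := (hf.hasStrictFDerivAt_gradient a).isLittleO.def hc
  rw [nhds_prod_eq] at hs
  obtain ⟨R, hR, hb⟩ := (Metric.nhds_basis_ball (x := a)).prod_self.mem_iff.1 hs
  refine ⟨R, hR, fun x hx y hy => ?_⟩
  have hseg : segment ℝ x y ⊆ Metric.ball a R := (convex_ball a R).segment_subset hx hy
  -- `F` is `f` minus its quadratic model, so its gradient is the strict-differentiability remainder
  -- of `g`; the mean value inequality then applies.
  set F : E → ℝ := fun z => f z - inner ℝ (g x) (z - x) - inner ℝ (H (z - x)) (z - x) / 2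
  have hF : ∀ z, HasFDerivAt F (InnerProductSpace.toDual ℝ E (g z - g x - H (z - x))) z := by
    intro z
    have h1 := hf.hasFDerivAt_toDual_gradient z
    have hid : HasFDerivAt (fun z : E => z - x) (ContinuousLinearMap.id ℝ E) z :=
      (hasFDerivAt_id z).sub_const x
    have h2 := (hasFDerivAt_const (g x) z).inner ℝ hid
    have hH : HasFDerivAt (fun z : E => H (z - x)) (H ∘L ContinuousLinearMap.id ℝ E) z :=
      H.hasFDerivAt.comp z hid
    have h3 := (hH.inner ℝ hid).const_mul (1 / 2 : ℝ)
    have h4 := (h1.sub h2).sub h3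
    refine (h4.congr_fderiv ?_).congr_of_eventuallyEq (Eventually.of_forall fun w => ?_)
    · ext w
      have h5 : inner ℝ (H w) (z - x) = inner ℝ (H (z - x)) w := by
        rw [inner_fderiv_gradient_comm hf a w (z - x), real_inner_comm]
      have h6 : (InnerProductSpace.toDual ℝ E (g z - g x - H (z - x))) w
          = inner ℝ (g z) w - inner ℝ (g x) w - inner ℝ (H (z - x)) w := by
        rw [InnerProductSpace.toDual_apply_apply, inner_sub_left, inner_sub_left]
      rw [h6]
      simp only [sub_apply, smul_apply,
        ContinuousLinearMap.comp_apply, ContinuousLinearMap.prod_apply, fderivInnerCLM_apply,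
        zero_apply, ContinuousLinearMap.id_apply, inner_zero_left, h5,
        InnerProductSpace.toDual_apply_apply, smul_eq_mul]
      ring
    · simp only [F, Pi.sub_apply]; ring
  have hmv := Convex.norm_image_sub_le_of_norm_hasFDerivWithin_le (f := F) (s := segment ℝ x y)
    (C := c * ‖y - x‖) (fun z _ => (hF z).hasFDerivWithinAt) (fun z hz => ?_)
    (convex_segment x y) (left_mem_segment ℝ x y) (right_mem_segment ℝ x y)
  · have e : F y - F x = f y - f x - inner ℝ (g x) (y - x) - inner ℝ (H (y - x)) (y - x) / 2 := by
      simp [F]; ring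
    rw [e, Real.norm_eq_abs] at hmv
    calc _ ≤ _ := hmv
      _ = _ := by ring
  · have h1 : ‖g z - g x - H (z - x)‖ ≤ c * ‖z - x‖ := @hb (z, x) ⟨hseg hz, hx⟩
    rw [LinearIsometryEquiv.norm_map]
    refine h1.trans (mul_le_mul_of_nonneg_left ?_ hc.le)
    rw [← dist_eq_norm, ← dist_eq_norm, dist_comm y x, dist_comm z x]
    have := dist_add_dist_of_mem_segment hz
    linarith [dist_nonneg (x := z) (y := y)]

/-- The Hessian at a local minimizer is positive semidefinite. -/
theorem IsLocalMin.inner_fderiv_gradient_nonneg {f : E → ℝ} {a : E} (h : IsLocalMin f a)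
    (hf : ContDiff ℝ 2 f) (u : E) : 0 ≤ inner ℝ (fderiv ℝ (gradient f) a u) u := by
  refine le_of_forall_pos_le_add fun δ hδ => ?_
  set c := δ / (2 * (‖u‖ ^ 2 + 1))
  have hc : 0 < c := by positivity
  obtain ⟨R, hR, hT⟩ := exists_ball_taylor_two hf a hc
  have hcont : Tendsto (fun t : ℝ => a + t • u) (𝓝[>] 0) (𝓝 a) := by
    have : Continuous fun t : ℝ => a + t • u := by fun_prop
    simpa using (this.tendsto 0).mono_left nhdsWithin_le_nhds
  have hev : ∀ᶠ t in 𝓝[>] (0 : ℝ), 0 < t ∧ f a ≤ f (a + t • u) ∧ a + t • u ∈ Metric.ball a R :=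
    Filter.Eventually.and self_mem_nhdsWithin ((hcont.eventually h).and (hcont (Metric.ball_mem_nhds a hR)))
  obtain ⟨t, ht, hft, htR⟩ := hev.exists
  have h1 := hT a (Metric.mem_ball_self hR) _ htR
  rw [h.gradient_eq_zero] at h1
  simp only [add_sub_cancel_left, inner_zero_left, map_smul, inner_smul_left,
    inner_smul_right, norm_smul, Real.norm_eq_abs, abs_of_pos ht] at h1
  have h2 := (abs_le.1 h1).2
  simp only [conj_trivial] at h2
  have h3 : t ^ 2 * (-(inner ℝ (fderiv ℝ (gradient f) a u) u / 2)) ≤ t ^ 2 * (c * ‖u‖ ^ 2) := by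
    nlinarith
  have h4 := le_of_mul_le_mul_left h3 (by positivity)
  have h5 : c * ‖u‖ ^ 2 ≤ δ / 2 := by
    have : c * (‖u‖ ^ 2 + 1) = δ / 2 := by simp only [c]; field_simp
    nlinarith
  linarith

end Calculus

/-! ### Consequence of the PL inequality for gradients in the kernel. -/

section PolyakLojasiewicz

variable {d : ℕ} {f : EuclideanSpace ℝ (Fin d) → ℝ} {xs : EuclideanSpace ℝ (Fin d)}

/-- Under the Polyak–Łojasiewicz condition, a point near `xs` at which the gradient lies in the
kernel of the Hessian at `xs` is a local minimizer at the level of `xs`. -/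
theorem LocalPL.eventually_mem_minimizerSet (hPL : LocalPL f xs) (hf : ContDiff ℝ 2 f)
    (hmin : IsLocalMin f xs) :
    ∀ᶠ x in 𝓝 xs, hessian f xs (gradient f x) = 0 → x ∈ minimizerSet f xs := by
  obtain ⟨U, hU, hxU, ν, hν, hPL⟩ := hPL
  -- The step is `-(2/ν) w` with `w = ∇f x`. As `H w = 0`, the Taylor error `ν/4` costs `‖w‖²/ν` out
  -- of the first-order gain `2‖w‖²/ν`.
  obtain ⟨R, hR, hT⟩ := exists_ball_taylor_two hf xs (c := ν / 4) (by positivity)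
  have hcont : Tendsto (fun x => x - (2 / ν) • gradient f x) (𝓝 xs) (𝓝 xs) := by
    have : Continuous fun x => x - (2 / ν) • gradient f x :=
      continuous_id.sub (Continuous.smul (f := fun _ => 2 / ν) continuous_const
        hf.gradient_one.continuous)
    simpa [hmin.gradient_eq_zero] using this.tendsto xs
  filter_upwards [hU.mem_nhds hxU, Metric.ball_mem_nhds xs hR, hcont (Metric.ball_mem_nhds xs hR),
    hcont.eventually hmin, hmin, hmin.eventually_nhds] with x hxU hxR hyR hfy hfx hnhds hH
  have h1 := hT x hxR (x - (2 / ν) • gradient f x) hyR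
  have h3 := hPL x hxU
  generalize gradient f x = w at h1 h3 hfy hH
  have hH' : fderiv ℝ (gradient f) xs w = 0 := hH
  have e : x - (2 / ν) • w - x = -((2 / ν) • w) := by abel
  rw [e] at h1
  simp only [map_neg, map_smul, hH', smul_zero, neg_zero, inner_zero_left, zero_div, sub_zero, mul_zero,
    norm_neg, norm_smul, inner_neg_right, inner_smul_right, Real.norm_eq_abs,
    real_inner_self_eq_norm_sq] at h1
  have h2 := (abs_le.1 h1).2
  rw [abs_of_pos (by positivity : (0 : ℝ) < 2 / ν)] at h2
  have h4 : ν / 4 * (2 / ν * ‖w‖) ^ 2 = ‖w‖ ^ 2 / ν := by field_simp; ring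
  rw [h4] at h2
  have h5 : 2 / ν * ‖w‖ ^ 2 = 2 * (‖w‖ ^ 2 / ν) := by ring
  have h6 : 2 * (f x - f xs) ≤ ‖w‖ ^ 2 / ν := by
    rw [le_div_iff₀ hν]; nlinarith
  -- The step gains at least `‖w‖²/ν ≥ 2 (f x - f xs)`, but cannot go below `f xs`.
  have hfx' : f x = f xs := le_antisymm (by linarith) hfx
  refine ⟨?_, hfx'⟩
  filter_upwards [hnhds] with y hy
  rw [hfx']; exact hy

end PolyakLojasiewicz

/-! ### Symmetric operators and the complement of their kernel. -/

section SymmetricKernel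

variable {E : Type*} [NormedAddCommGroup E] [InnerProductSpace ℝ E]
  {H : E →L[ℝ] E} {K : Submodule ℝ E} [K.HasOrthogonalProjection]

theorem starProjection_ker_orthogonal_apply_map (hH : ∀ u w, inner ℝ (H u) w = inner ℝ u (H w))
    (hK : K = H.ker) (u : E) : Kᗮ.starProjection (H u) = H u := by
  refine Submodule.starProjection_eq_self_iff.2 ((Submodule.mem_orthogonal' _ _).2 fun w hw => ?_)
  have : H w = 0 := by rw [hK] at hw; exact hw
  rw [hH, this, inner_zero_right]

theorem map_starProjection_ker_orthogonal (hK : K = H.ker) (u : E) :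
    H (Kᗮ.starProjection u) = H u := by
  have h1 : K.starProjection u ∈ H.ker := hK ▸ K.starProjection_apply_mem u
  have h2 : H (K.starProjection u) = 0 := h1
  rw [Submodule.starProjection_orthogonal_val, map_sub, h2, sub_zero]

end SymmetricKernel

/-! ### Normal coordinate and parametrization of its zero set. -/

section NormalCoordinate

variable {E : Type*} [NormedAddCommGroup E] [InnerProductSpace ℝ E] [FiniteDimensional ℝ E]

/-- For a `C¹` map `g` vanishing at `a` whose derivative `H` at `a` is symmetric, there is a `C¹`
map `q` into the range of `H` whose derivative at `a` is the projection to that range, with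
`H ∘ q` the projection of `g`. -/
theorem exists_normal_coordinate {g : E → E} {a : E} (hg : ContDiff ℝ 1 g) (hga : g a = 0)
    {H : E →L[ℝ] E} (hgH : HasStrictFDerivAt g H a)
    (hH : ∀ u w, inner ℝ (H u) w = inner ℝ u (H w)) {K : Submodule ℝ E} (hK : K = H.ker) :
    ∃ q : E → E, ContDiff ℝ 1 q ∧ q a = 0 ∧ HasStrictFDerivAt q Kᗮ.starProjection a ∧
      (∀ x, Kᗮ.starProjection (q x) = q x) ∧ ∀ x, H (q x) = Kᗮ.starProjection (g x) := by
  set P := Kᗮ.starProjection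
  have hPP : ∀ u, P (P u) = P u := fun u =>
    Submodule.starProjection_eq_self_iff.2 (Submodule.starProjection_apply_mem _ u)
  have hPH : ∀ u, P (H u) = H u := starProjection_ker_orthogonal_apply_map hH hK
  have hHP : ∀ u, H (P u) = H u := map_starProjection_ker_orthogonal hK
  -- `L` is the identity on `K` and `H` on `Kᗮ`, hence invertible; `P` composed with its inverse is
  -- a pseudo-inverse of `H`.
  set L : E →L[ℝ] E := ContinuousLinearMap.id ℝ E - P + H
  have hL : ∀ u, L u = u - P u + H u := fun u => rfl
  have hinj : Function.Injective (L : E →ₗ[ℝ] E) := by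
    refine (injective_iff_map_eq_zero _).2 fun u hu => ?_
    have hu' : u - P u + H u = 0 := hu
    have h1 : H u = 0 := by
      have := congrArg P hu'
      simpa [hPP, hPH] using this
    have h2 : P u = 0 := by
      have : u ∈ Kᗮᗮ := Submodule.le_orthogonal_orthogonal K (hK ▸ h1)
      exact (Submodule.starProjection_apply_eq_zero_iff _).2 this
    simpa [h1, h2] using hu'
  set B : E →L[ℝ] E :=
    ((LinearEquiv.ofInjectiveEndo (L : E →ₗ[ℝ] E) hinj).toContinuousLinearEquiv.symm : E →L[ℝ] E)
  have hLB : ∀ u, L (B u) = u := fun u =>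
    (LinearEquiv.ofInjectiveEndo (L : E →ₗ[ℝ] E) hinj).apply_symm_apply u
  have hBL : ∀ u, B (L u) = u := fun u =>
    (LinearEquiv.ofInjectiveEndo (L : E →ₗ[ℝ] E) hinj).symm_apply_apply u
  have hHB : ∀ u, H (B u) = P u := fun u => by
    have := congrArg P (hLB u)
    simpa [hL, hPP, hPH] using this
  have hBH : ∀ u, B (H u) = P u := fun u => by
    have : L (P u) = H u := by rw [hL, hPP, hHP, sub_self, zero_add]
    rw [← this, hBL]
  refine ⟨fun x => P (B (g x)), (P ∘L B).contDiff.comp hg, by simp [hga], ?_, fun x => hPP _,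
    fun x => by rw [hHP, hHB]⟩
  have h := ((P ∘L B).hasStrictFDerivAt (x := g a)).comp a hgH
  refine h.congr_fderiv ?_
  ext u
  simp [hBH, hPP]

/-- The zero set of a normal coordinate is parametrized by the kernel of its derivative. -/
theorem exists_section_of_normal_coordinate {q : E → E} {a : E} (hq : ContDiff ℝ 1 q)
    (hqa : q a = 0) {N : Submodule ℝ E} (hqN : HasStrictFDerivAt q N.starProjection a)
    (hqm : ∀ x, N.starProjection (q x) = q x) :
    ∃ σ : E → E, ContDiffAt ℝ 1 σ 0 ∧ σ 0 = a ∧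
      HasStrictFDerivAt σ (ContinuousLinearMap.id ℝ E) 0 ∧
      (∀ᶠ w in 𝓝 (0 : E), w ∈ Nᗮ → q (σ w) = 0) ∧
      ∀ᶠ x in 𝓝 a, ‖x - σ (x - a - N.starProjection (x - a))‖ ≤ 2 * ‖q x‖ := by
  have : CompleteSpace E := FiniteDimensional.complete ℝ E
  set P := N.starProjection
  have hPP : ∀ u, P (P u) = P u := fun u =>
    Submodule.starProjection_eq_self_iff.2 (Submodule.starProjection_apply_mem _ u)
  -- Tangential coordinate plus `q`: the derivative at `a` is the identity, and the local inverse of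
  -- `G` is the parametrization.
  set G : E → E := fun x => (ContinuousLinearMap.id ℝ E - P) (x - a) + q x
  have hGa : G a = 0 := by simp [G, hqa]
  have hGc : ContDiff ℝ 1 G :=
    ((ContinuousLinearMap.id ℝ E - P).contDiff.comp (contDiff_id.sub contDiff_const)).add hq
  have hGd : HasStrictFDerivAt G ((ContinuousLinearEquiv.refl ℝ E : E ≃L[ℝ] E) : E →L[ℝ] E) a := by
    have h1 : HasStrictFDerivAt (fun x : E => x - a) (ContinuousLinearMap.id ℝ E) a :=
      (hasStrictFDerivAt_id a).sub_const a
    have h2 := (((ContinuousLinearMap.id ℝ E - P).hasStrictFDerivAt).comp a h1).add hqN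
    refine h2.congr_fderiv ?_
    ext u
    simp
  have hPG : ∀ x, P (G x) = q x := fun x => by
    simp only [G, map_add, hqm, sub_apply, ContinuousLinearMap.id_apply, map_sub, hPP]
    simp
  have hσd := hGd.to_localInverse
  have hσt := hGd.localInverse_tendsto
  have hσa : hGd.localInverse (f := G) (f' := ContinuousLinearEquiv.refl ℝ E) (a := a) (G a) = a :=
    hGd.localInverse_apply_image
  have hinv := hGd.eventually_right_inverse
  have hσc : ContDiffAt ℝ 1 (hGd.localInverse (f := G) (f' := ContinuousLinearEquiv.refl ℝ E)
      (a := a)) (G a) :=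
    hGc.contDiffAt.to_localInverse (f' := ContinuousLinearEquiv.refl ℝ E) hGd.hasFDerivAt one_ne_zero
  set σ := hGd.localInverse (f := G) (f' := ContinuousLinearEquiv.refl ℝ E) (a := a)
  rw [hGa] at hσd hσt hσa hinv hσc
  refine ⟨σ, hσc, hσa, hσd, ?_, ?_⟩
  · filter_upwards [hinv] with w hw hwN
    rw [← hPG, hw]
    exact (Submodule.starProjection_apply_eq_zero_iff _).2 hwN
  -- The point `y` below has the tangential coordinate of `x` and `q y = 0`, so `G x - G y = q x`;
  -- since `G` is nearly the identity, this controls `x - y`.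
  · have hs := hGd.isLittleO.def (c := 1 / 2) (by norm_num)
    have ht : Tendsto (fun x => x - a - P (x - a)) (𝓝 a) (𝓝 0) := by
      have : Continuous fun x => x - a - P (x - a) := by fun_prop
      simpa using this.tendsto a
    have ht2 : Tendsto (fun x => (x, σ (x - a - P (x - a)))) (𝓝 a) (𝓝 (a, a)) :=
      tendsto_id.prodMk_nhds (hσt.comp ht)
    filter_upwards [ht2.eventually hs, ht.eventually hinv] with x hx hGx
    set y := σ (x - a - P (x - a))
    have e : G x - G y = q x := by
      rw [hGx]; simp [G]
    simp only [ContinuousLinearEquiv.coe_refl, ContinuousLinearMap.id_apply] at hx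
    rw [e] at hx
    have h3 : ‖x - y‖ ≤ ‖q x‖ + ‖q x - (x - y)‖ := by
      have := norm_sub_le (q x) (q x - (x - y))
      simpa using this
    linarith

end NormalCoordinate

/-! ### Local structure of the set of minimizers. -/

section MinimizerSet

variable {d : ℕ} {f : EuclideanSpace ℝ (Fin d) → ℝ} {xs : EuclideanSpace ℝ (Fin d)}

/-- A normal coordinate adapted to the set of minimizers of `f` near `xs`: a `C¹` map `q` into the
orthogonal complement of the kernel of the Hessian. It vanishes only on minimizers and the
gradient is `hessian f xs ∘ q` up to an error of higher order. -/
theorem LocalPL.exists_normal_coordinate (hPL : LocalPL f xs) (hf : ContDiff ℝ 2 f)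
    (hmin : IsLocalMin f xs) :
    ∃ q : EuclideanSpace ℝ (Fin d) → EuclideanSpace ℝ (Fin d), ContDiff ℝ 1 q ∧ q xs = 0 ∧
      HasStrictFDerivAt q (hessian f xs).kerᗮ.starProjection xs ∧
      (∀ x, (hessian f xs).kerᗮ.starProjection (q x) = q x) ∧
      (∀ᶠ x in 𝓝 xs, q x = 0 → x ∈ minimizerSet f xs) ∧
      ∀ η > 0, ∀ᶠ x in 𝓝 xs, ‖gradient f x - hessian f xs (q x)‖ ≤ η * ‖q x‖ := by
  set H := hessian f xs with hHdef
  have hH : ∀ u w, inner ℝ (H u) w = inner ℝ u (H w) := inner_fderiv_gradient_comm hf xs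
  have hgH : HasStrictFDerivAt (gradient f) H xs := hf.hasStrictFDerivAt_gradient xs
  obtain ⟨q, hq, hq0, hqd, hqP, hHq⟩ :=
    _root_.exists_normal_coordinate hf.gradient_one hmin.gradient_eq_zero hgH hH rfl
  obtain ⟨σ, -, hσ0, hσd, hσq, hσx⟩ := exists_section_of_normal_coordinate hq hq0 hqd hqP
  set P := H.kerᗮ.starProjection
  have hmem : ∀ᶠ x in 𝓝 xs, q x = 0 → x ∈ minimizerSet f xs := by
    filter_upwards [hPL.eventually_mem_minimizerSet hf hmin] with x hx hqx
    refine hx ?_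
    rw [← hHdef, ← map_starProjection_ker_orthogonal (H := H) rfl, ← hHq, hqx, map_zero, map_zero]
  refine ⟨q, hq, hq0, hqd, hqP, hmem, fun η hη => ?_⟩
  -- The range of `H` lies in `(ker H)ᗮ`, so the tangential part of the gradient has derivative
  -- zero. It vanishes at the minimizer `y` below, hence is `o(‖x - y‖)`, and `‖x - y‖ ≤ 2‖q x‖`.
  have hs : HasStrictFDerivAt (fun x => gradient f x - P (gradient f x))
      (0 : EuclideanSpace ℝ (Fin d) →L[ℝ] EuclideanSpace ℝ (Fin d)) xs := by
    refine (hgH.sub (P.hasStrictFDerivAt.comp xs hgH)).congr_fderiv ?_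
    ext1 u
    have : P (H u) = H u := starProjection_ker_orthogonal_apply_map hH rfl u
    simp [this]
  have ht : Tendsto (fun x => x - xs - P (x - xs)) (𝓝 xs) (𝓝 0) := by
    have : Continuous fun x => x - xs - P (x - xs) := by fun_prop
    simpa using this.tendsto xs
  have hσt : Tendsto (fun x => σ (x - xs - P (x - xs))) (𝓝 xs) (𝓝 xs) := by
    have := hσd.continuousAt.tendsto
    rw [hσ0] at this
    exact this.comp ht
  have ht2 : Tendsto (fun x => (x, σ (x - xs - P (x - xs)))) (𝓝 xs) (𝓝 (xs, xs)) :=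
    tendsto_id.prodMk_nhds hσt
  filter_upwards [ht.eventually hσq, hσt.eventually hmem, hσx,
    ht2.eventually (hs.isLittleO.def (half_pos hη))] with x h1 h2 h3 h4
  set y := σ (x - xs - P (x - xs))
  have hy : y ∈ minimizerSet f xs := h2 (h1 (H.kerᗮ.sub_starProjection_mem_orthogonal (x - xs)))
  have hgy : gradient f y = 0 := hy.1.gradient_eq_zero
  simp only [hgy, map_zero, sub_zero, zero_apply] at h4
  rw [hHq]
  calc _ ≤ η / 2 * ‖x - y‖ := h4
    _ ≤ η / 2 * (2 * ‖q x‖) := by gcongr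
    _ = η * ‖q x‖ := by ring

/-- The normal space of the set of minimizers is the orthogonal complement of the kernel of the
Hessian. -/
theorem LocalPL.normalSpaceAt_eq (hPL : LocalPL f xs) (hf : ContDiff ℝ 2 f)
    (hmin : IsLocalMin f xs) :
    normalSpaceAt (minimizerSet f xs) xs = (hessian f xs).kerᗮ := by
  have hgH : HasStrictFDerivAt (gradient f) (hessian f xs) xs := hf.hasStrictFDerivAt_gradient xs
  suffices h : tangentVectors (minimizerSet f xs) xs = ((hessian f xs).ker : Set _) by
    rw [normalSpaceAt, h, Submodule.span_eq]
  ext w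
  constructor
  -- The gradient vanishes along `c`; differentiating gives `H w = 0`.
  · rintro ⟨δ, c, hδ, hc, hcS, hc0, hcw⟩
    have h0 : Ioo (-δ) δ ∈ 𝓝 (0 : ℝ) := Ioo_mem_nhds (by linarith) hδ
    have hcd : HasDerivAt c w 0 := by
      rw [← hcw]
      exact ((hc.contDiffAt h0).differentiableAt one_ne_zero).hasDerivAt
    have h1 : HasDerivAt (gradient f ∘ c) (hessian f xs w) 0 :=
      HasFDerivAt.comp_hasDerivAt (0 : ℝ) (by rw [hc0]; exact hgH.hasFDerivAt) hcd
    have h2 : HasDerivAt (gradient f ∘ c) 0 0 := by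
      refine (hasDerivAt_const (0 : ℝ) (0 : EuclideanSpace ℝ (Fin d))).congr_of_eventuallyEq ?_
      filter_upwards [h0] with t ht
      exact (hcS t ht).1.gradient_eq_zero
    exact h1.unique h2
  -- The curve `t ↦ σ (t • w)` has velocity `w`.
  · intro hw
    obtain ⟨q, hq, hq0, hqd, hqP, hmem, -⟩ := hPL.exists_normal_coordinate hf hmin
    obtain ⟨σ, hσc, hσ0, hσd, hσq, -⟩ := exists_section_of_normal_coordinate hq hq0 hqd hqP
    have hcont : Continuous fun t : ℝ => t • w := by fun_prop
    have ht : Tendsto (fun t : ℝ => t • w) (𝓝 0) (𝓝 0) := by simpa using hcont.tendsto 0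
    have hσt : Tendsto σ (𝓝 0) (𝓝 xs) := by simpa [hσ0] using hσd.continuousAt.tendsto
    have hσe : ∀ᶠ y in 𝓝 0, ContDiffAt ℝ 1 σ y := hσc.eventually (by simp)
    have hev : ∀ᶠ t in 𝓝 (0 : ℝ), ContDiffAt ℝ 1 σ (t • w) ∧ σ (t • w) ∈ minimizerSet f xs := by
      filter_upwards [ht.eventually hσe, ht.eventually hσq, ht.eventually (hσt.eventually hmem)]
        with t h1 h2 h3
      refine ⟨h1, h3 (h2 ?_)⟩
      exact Submodule.le_orthogonal_orthogonal _ (Submodule.smul_mem _ _ hw)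
    obtain ⟨δ, hδ, hball⟩ := Metric.eventually_nhds_iff_ball.1 hev
    rw [Real.ball_eq_Ioo, zero_sub, zero_add] at hball
    refine ⟨δ, fun t => σ (t • w), hδ, fun t ht => ?_, fun t ht => (hball t ht).2, by simp [hσ0], ?_⟩
    · exact ((hball t ht).1.comp t (contDiff_id.smul contDiff_const).contDiffAt).contDiffWithinAt
    · have h1 : HasDerivAt (fun t : ℝ => t • w) w 0 := by
        simpa using (hasDerivAt_id (0 : ℝ)).smul_const w
      have h2 : HasFDerivAt σ (ContinuousLinearMap.id ℝ _) ((0 : ℝ) • w) := by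
        rw [zero_smul]; exact hσd.hasFDerivAt
      exact (HasFDerivAt.comp_hasDerivAt (0 : ℝ) h2 h1).deriv

/-- If `f` is not constant near `xs`, the Hessian does not vanish at `xs`. -/
theorem LocalPL.ker_hessian_orthogonal_ne_bot (hPL : LocalPL f xs) (hf : ContDiff ℝ 2 f)
    (hmin : IsLocalMin f xs) (hnonconst : ¬ ∀ᶠ x in 𝓝 xs, f x = f xs) :
    (hessian f xs).kerᗮ ≠ ⊥ := by
  intro h
  refine hnonconst ?_
  have htop : (hessian f xs).ker = ⊤ := Submodule.orthogonal_eq_bot_iff.1 h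
  filter_upwards [hPL.eventually_mem_minimizerSet hf hmin] with x hx
  exact (hx (show gradient f x ∈ (hessian f xs).ker by rw [htop]; trivial)).2

end MinimizerSet

/-! ### Smallest positive eigenvalue of the Hessian. -/

section Spectral

variable {E : Type*} [NormedAddCommGroup E] [InnerProductSpace ℝ E] [FiniteDimensional ℝ E]

/-- A positive semidefinite operator has a smallest eigenvalue on the orthogonal complement of its
kernel; it is positive and bounds the quadratic form from below. -/
theorem exists_isLeast_eigenvalue_ker_orthogonal {H : E →L[ℝ] E}
    (hH : ∀ u w, inner ℝ (H u) w = inner ℝ u (H w)) (hpos : ∀ u, 0 ≤ inner ℝ (H u) u)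
    (hne : H.kerᗮ ≠ ⊥) :
    ∃ μ > 0, IsLeast {l : ℝ | ∃ v ∈ H.kerᗮ, v ≠ 0 ∧ H v = l • v} μ ∧
      ∀ v ∈ H.kerᗮ, μ * ‖v‖ ^ 2 ≤ inner ℝ (H v) v := by
  have hinv : ∀ v ∈ H.kerᗮ, (H : E →ₗ[ℝ] E) v ∈ H.kerᗮ := fun v _ =>
    Submodule.starProjection_eq_self_iff.1 (starProjection_ker_orthogonal_apply_map hH rfl v)
  have : Nontrivial H.kerᗮ := Submodule.nontrivial_iff_ne_bot.2 hne
  set T : H.kerᗮ →ₗ[ℝ] H.kerᗮ := (H : E →ₗ[ℝ] E).restrict hinv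
  have hT : T.IsSymmetric := fun u w => hH u w
  -- The infimum of the Rayleigh quotient is an eigenvalue.
  have heig := hT.hasEigenvalue_iInf_of_finiteDimensional
  set μ : ℝ := ⨅ x : {x : H.kerᗮ // x ≠ 0}, RCLike.re (inner ℝ (T x) (x : H.kerᗮ)) / ‖(x : H.kerᗮ)‖ ^ 2
  have hbdd : BddBelow (range fun x : {x : H.kerᗮ // x ≠ 0} =>
      RCLike.re (inner ℝ (T x) (x : H.kerᗮ)) / ‖(x : H.kerᗮ)‖ ^ 2) := by
    refine ⟨0, ?_⟩
    rintro _ ⟨x, rfl⟩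
    exact div_nonneg (hpos x) (by positivity)
  have hle : ∀ v ∈ H.kerᗮ, μ * ‖v‖ ^ 2 ≤ inner ℝ (H v) v := by
    intro v hv
    rcases eq_or_ne v 0 with rfl | hv0
    · simp
    · have h1 : μ ≤ inner ℝ (H v) v / ‖v‖ ^ 2 :=
        ciInf_le hbdd (⟨⟨v, hv⟩, fun h => hv0 (congrArg Subtype.val h)⟩ : {x : H.kerᗮ // x ≠ 0})
      rwa [le_div_iff₀ (by positivity)] at h1
  have hmem : μ ∈ {l : ℝ | ∃ v ∈ H.kerᗮ, v ≠ 0 ∧ H v = l • v} := by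
    obtain ⟨v, hv⟩ := heig.exists_hasEigenvector
    refine ⟨v, v.2, fun h => hv.2 (Subtype.ext h), ?_⟩
    exact congrArg Subtype.val hv.apply_eq_smul
  have hposl : ∀ l ∈ {l : ℝ | ∃ v ∈ H.kerᗮ, v ≠ 0 ∧ H v = l • v}, μ ≤ l := by
    rintro l ⟨v, hv, hv0, hl⟩
    have h1 := hle v hv
    rw [hl, inner_smul_left, real_inner_self_eq_norm_sq] at h1
    exact le_of_mul_le_mul_right h1 (by positivity)
  refine ⟨μ, ?_, ⟨hmem, hposl⟩, hle⟩
  obtain ⟨v, hv, hv0, hl⟩ := hmem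
  have h1 := hpos v
  rw [hl, inner_smul_left, real_inner_self_eq_norm_sq] at h1
  have h2 : 0 ≤ μ := nonneg_of_mul_nonneg_left h1 (by positivity)
  refine lt_of_le_of_ne h2 fun h => hv0 ?_
  rw [← h, zero_smul] at hl
  have h3 : inner ℝ v v = 0 := (Submodule.mem_orthogonal _ _).1 hv v hl
  exact inner_self_eq_zero.1 h3

end Spectral

/-- The smallest normal eigenvalue of the Hessian is attained, positive, and bounds the Hessian
from below on the orthogonal complement of its kernel. -/
theorem LocalPL.normalMu_spec {d : ℕ} {f : EuclideanSpace ℝ (Fin d) → ℝ}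
    {xs : EuclideanSpace ℝ (Fin d)} (hPL : LocalPL f xs) (hf : ContDiff ℝ 2 f)
    (hmin : IsLocalMin f xs) (hnonconst : ¬ ∀ᶠ x in 𝓝 xs, f x = f xs) :
    IsLeast (normalEigenvalues f xs) (normalMu f xs) ∧ 0 < normalMu f xs ∧
      ∀ v ∈ (hessian f xs).kerᗮ, normalMu f xs * ‖v‖ ^ 2 ≤ inner ℝ (hessian f xs v) v := by
  obtain ⟨μ, hμ, hl, hle⟩ := exists_isLeast_eigenvalue_ker_orthogonal
    (inner_fderiv_gradient_comm hf xs) (hmin.inner_fderiv_gradient_nonneg hf)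
    (hPL.ker_hessian_orthogonal_ne_bot hf hmin hnonconst)
  have hset : IsLeast (normalEigenvalues f xs) μ := by
    rw [normalEigenvalues, hPL.normalSpaceAt_eq hf hmin]
    exact hl
  have hmu : normalMu f xs = μ := hset.csInf_eq
  rw [hmu]
  exact ⟨hset, hμ, hle⟩

/-! ### Lyapunov function of the linearized system. -/

section Energy

variable {E : Type*} [NormedAddCommGroup E] [InnerProductSpace ℝ E]

/-- A quadratic Lyapunov function, with decay rate `2 * r`, of the linear system `q' = v`,
`v' = -γ v - H q`. -/
noncomputable def heavyBallEnergy (H : E →L[ℝ] E) (γ r : ℝ) (q v : E) : ℝ :=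
  ‖v + r • q‖ ^ 2 + (inner ℝ (H q) q - (γ * r - r ^ 2) * ‖q‖ ^ 2)

theorem heavyBallEnergy_le {H : E →L[ℝ] E} {γ r : ℝ} (q v : E) :
    heavyBallEnergy H γ r q v ≤ (2 + 2 * r ^ 2 + ‖H‖ + |γ * r - r ^ 2|) * (‖q‖ ^ 2 + ‖v‖ ^ 2) := by
  have h1 : inner ℝ (H q) q ≤ ‖H‖ * ‖q‖ ^ 2 := by
    calc inner ℝ (H q) q ≤ ‖H q‖ * ‖q‖ := real_inner_le_norm _ _
      _ ≤ ‖H‖ * ‖q‖ * ‖q‖ := by gcongr; exact H.le_opNorm q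
      _ = ‖H‖ * ‖q‖ ^ 2 := by ring
  have h2 : ‖v + r • q‖ ^ 2 ≤ 2 * ‖v‖ ^ 2 + 2 * r ^ 2 * ‖q‖ ^ 2 := by
    have h3 : ‖v + r • q‖ ≤ ‖v‖ + |r| * ‖q‖ := by
      simpa [norm_smul] using norm_add_le v (r • q)
    have h4 : ‖v + r • q‖ ^ 2 ≤ (‖v‖ + |r| * ‖q‖) ^ 2 := by gcongr
    nlinarith [sq_nonneg (‖v‖ - |r| * ‖q‖), sq_abs r]
  have h5 := neg_abs_le (γ * r - r ^ 2)
  have hH := norm_nonneg H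
  have ha := abs_nonneg (γ * r - r ^ 2)
  have h6 : -((γ * r - r ^ 2) * ‖q‖ ^ 2) ≤ |γ * r - r ^ 2| * ‖q‖ ^ 2 := by
    nlinarith [sq_nonneg ‖q‖]
  have h7 : 0 ≤ r ^ 2 * ‖v‖ ^ 2 + ‖H‖ * ‖v‖ ^ 2 + |γ * r - r ^ 2| * ‖v‖ ^ 2 + ‖q‖ ^ 2 := by
    positivity
  have h8 : 0 ≤ r ^ 2 * ‖v‖ ^ 2 := by positivity
  have h9 : 0 ≤ ‖q‖ ^ 2 := by positivity
  unfold heavyBallEnergy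
  nlinarith

/-- Coercivity: `α` is the gap left between the spectrum on the normal space and the subtracted `γ r
- r²`. -/
theorem le_heavyBallEnergy {H : E →L[ℝ] E} {γ r α μ : ℝ} (hα : 0 < α)
    (hμ : α + (γ * r - r ^ 2) ≤ μ) {q : E} (hq : μ * ‖q‖ ^ 2 ≤ inner ℝ (H q) q) (v : E) :
    ‖q‖ ^ 2 + ‖v‖ ^ 2 ≤ (2 + (2 * r ^ 2 + 1) / α) * heavyBallEnergy H γ r q v := by
  have h1 : ‖v‖ ^ 2 ≤ 2 * ‖v + r • q‖ ^ 2 + 2 * r ^ 2 * ‖q‖ ^ 2 := by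
    have h3 : ‖v‖ ≤ ‖v + r • q‖ + |r| * ‖q‖ := by
      simpa [norm_smul] using norm_sub_le (v + r • q) (r • q)
    have h4 : ‖v‖ ^ 2 ≤ (‖v + r • q‖ + |r| * ‖q‖) ^ 2 := by gcongr
    nlinarith [sq_nonneg (‖v + r • q‖ - |r| * ‖q‖), sq_abs r]
  have h2 : α * ‖q‖ ^ 2 ≤ inner ℝ (H q) q - (γ * r - r ^ 2) * ‖q‖ ^ 2 := by
    nlinarith [sq_nonneg ‖q‖]
  unfold heavyBallEnergy
  set A := inner ℝ (H q) q - (γ * r - r ^ 2) * ‖q‖ ^ 2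
  set B := ‖v + r • q‖ ^ 2
  have hB : 0 ≤ B := by positivity
  have hA : 0 ≤ A := le_trans (by positivity) h2
  have h3 : (2 * r ^ 2 + 1) * ‖q‖ ^ 2 ≤ (2 * r ^ 2 + 1) / α * A := by
    rw [div_mul_eq_mul_div, le_div_iff₀ hα]
    nlinarith [sq_nonneg r]
  have h4 : 0 ≤ (2 * r ^ 2 + 1) / α * B := by positivity
  nlinarith

/-- Dissipation of the energy along the linear system. -/
theorem heavyBallEnergy_dissipation {H : E →L[ℝ] E} {γ r : ℝ} (hr : 2 * r ≤ γ) (hr0 : 0 ≤ r)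
    {N : Submodule ℝ E} [N.HasOrthogonalProjection] {q : E} (hq : q ∈ N) (hHq : H q ∈ N) (v : E) :
    inner ℝ (v + r • q) (-(γ • v) - H q + r • N.starProjection v)
      + inner ℝ (H q - (γ * r - r ^ 2) • q) (N.starProjection v)
      ≤ -r * heavyBallEnergy H γ r q v := by
  set P := N.starProjection
  have e1 : ∀ w ∈ N, inner ℝ w (P v) = inner ℝ w v := fun w hw => by
    rw [← Submodule.inner_starProjection_left_eq_right, Submodule.starProjection_eq_self_iff.2 hw]
  -- Only the normal part of `v` moves `q`; its tangential part is merely damped, so an inequality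
  -- suffices.
  have e2 : inner ℝ v (P v) ≤ ‖v‖ ^ 2 := by
    calc inner ℝ v (P v) ≤ ‖v‖ * ‖P v‖ := real_inner_le_norm _ _
      _ ≤ ‖v‖ * ‖v‖ := by gcongr; exact N.norm_starProjection_apply_le v
      _ = ‖v‖ ^ 2 := by ring
  have e3 : ‖v + r • q‖ ^ 2 = ‖v‖ ^ 2 + 2 * r * inner ℝ q v + r ^ 2 * ‖q‖ ^ 2 := by
    rw [norm_add_sq_real, inner_smul_right, norm_smul, Real.norm_eq_abs, mul_pow, sq_abs,
      real_inner_comm]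
    ring
  have e4 : inner ℝ v (H q) = inner ℝ (H q) v := real_inner_comm _ _
  have e5 : inner ℝ q (H q) = inner ℝ (H q) q := real_inner_comm _ _
  have e6 : inner ℝ v q = inner ℝ q v := real_inner_comm _ _
  unfold heavyBallEnergy
  -- If `P v = v`, this square is exactly the slack in the inequality.
  have e7 : 0 ≤ (γ - 2 * r) * ‖v + r • q‖ ^ 2 := mul_nonneg (by linarith) (by positivity)
  rw [e3] at e7 ⊢
  simp only [inner_add_left, inner_add_right, inner_sub_left, inner_sub_right, inner_neg_right,
    inner_smul_left, inner_smul_right, e1 q hq, e1 (H q) hHq, real_inner_self_eq_norm_sq,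
    conj_trivial, e4, e5]
  have e8 : r * inner ℝ v (P v) ≤ r * ‖v‖ ^ 2 := by gcongr
  nlinarith

/-- Dissipation of the energy along small perturbations of the linear system. -/
theorem exists_perturbed_heavyBallEnergy_dissipation {H : E →L[ℝ] E} {γ r r' μ : ℝ}
    (hr : 2 * r ≤ γ) (hr0 : 0 ≤ r) (hr' : r' < r) (hμ : γ * r - r ^ 2 < μ)
    {N : Submodule ℝ E} [N.HasOrthogonalProjection] (hHN : ∀ u, H u ∈ N)
    (hH : ∀ q ∈ N, μ * ‖q‖ ^ 2 ≤ inner ℝ (H q) q) :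
    ∃ η > 0, ∀ q ∈ N, ∀ v e₁ e₂ : E, ‖e₁‖ ≤ η * ‖v‖ → ‖e₂‖ ≤ η * ‖q‖ →
      inner ℝ (v + r • q) (-(γ • v) - H q + e₂ + r • (N.starProjection v + e₁))
      + inner ℝ (H q - (γ * r - r ^ 2) • q) (N.starProjection v + e₁)
      ≤ -r' * heavyBallEnergy H γ r q v := by
  set κ := γ * r - r ^ 2
  set α := μ - κ
  have hα : 0 < α := sub_pos.2 hμ
  set c := 2 + (2 * r ^ 2 + 1) / α
  have hc : 0 < c := by positivity
  set D := 2 * ((1 + r) ^ 2 + ‖H‖ + |κ|)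
  have hD : 0 < D := by positivity
  -- Errors contribute at most `η (D/2) s²`, with `s = ‖q‖ + ‖v‖`, hence at most `η D c` times the
  -- energy; this `η` makes that `r - r'` times the energy.
  refine ⟨(r - r') / (c * D), div_pos (sub_pos.2 hr') (by positivity), fun q hq v e₁ e₂ h1 h2 => ?_⟩
  set η := (r - r') / (c * D)
  have hη : 0 < η := div_pos (sub_pos.2 hr') (by positivity)
  have hlow : ‖q‖ ^ 2 + ‖v‖ ^ 2 ≤ c * heavyBallEnergy H γ r q v :=
    le_heavyBallEnergy hα (by simp [α, κ]) (hH q hq) v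
  have hdis := heavyBallEnergy_dissipation hr hr0 hq (hHN q) v
  set Q := heavyBallEnergy H γ r q v
  set P := N.starProjection
  have e : inner ℝ (v + r • q) (-(γ • v) - H q + e₂ + r • (P v + e₁))
      + inner ℝ (H q - κ • q) (P v + e₁)
      = (inner ℝ (v + r • q) (-(γ • v) - H q + r • P v) + inner ℝ (H q - κ • q) (P v))
        + (inner ℝ (v + r • q) (e₂ + r • e₁) + inner ℝ (H q - κ • q) e₁) := by
    rw [smul_add, inner_add_right (H q - κ • q)]
    simp only [inner_add_right]
    ring
  rw [e]
  set s := ‖q‖ + ‖v‖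
  have hs : 0 ≤ s := by positivity
  have hvs : ‖v‖ ≤ s := le_add_of_nonneg_left (norm_nonneg q)
  have hqs : ‖q‖ ≤ s := le_add_of_nonneg_right (norm_nonneg v)
  have b1 : ‖v + r • q‖ ≤ (1 + r) * s := by
    calc ‖v + r • q‖ ≤ ‖v‖ + r * ‖q‖ := by
          simpa [norm_smul, abs_of_nonneg hr0] using norm_add_le v (r • q)
      _ ≤ s + r * s := by gcongr
      _ = (1 + r) * s := by ring
  have b2 : ‖e₂ + r • e₁‖ ≤ (1 + r) * (η * s) := by
    calc ‖e₂ + r • e₁‖ ≤ ‖e₂‖ + r * ‖e₁‖ := by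
          simpa [norm_smul, abs_of_nonneg hr0] using norm_add_le e₂ (r • e₁)
      _ ≤ η * s + r * (η * s) := by
          gcongr
          · exact h2.trans (by gcongr)
          · exact h1.trans (by gcongr)
      _ = (1 + r) * (η * s) := by ring
  have b3 : ‖H q - κ • q‖ ≤ (‖H‖ + |κ|) * s := by
    calc ‖H q - κ • q‖ ≤ ‖H q‖ + |κ| * ‖q‖ := by
          simpa [norm_smul] using norm_sub_le (H q) (κ • q)
      _ ≤ ‖H‖ * s + |κ| * s := by
          gcongr
          exact (H.le_opNorm q).trans (by gcongr)
      _ = (‖H‖ + |κ|) * s := by ring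
  have b4 : inner ℝ (v + r • q) (e₂ + r • e₁) ≤ (1 + r) * s * ((1 + r) * (η * s)) :=
    (real_inner_le_norm _ _).trans (by gcongr)
  have b5 : inner ℝ (H q - κ • q) e₁ ≤ (‖H‖ + |κ|) * s * (η * s) :=
    (real_inner_le_norm _ _).trans (by gcongr; exact h1.trans (by gcongr))
  have b6 : s ^ 2 ≤ 2 * (‖q‖ ^ 2 + ‖v‖ ^ 2) := by
    simp only [s]; nlinarith [sq_nonneg (‖q‖ - ‖v‖)]
  have b7 : (1 + r) * s * ((1 + r) * (η * s)) + (‖H‖ + |κ|) * s * (η * s) = η * (D / 2) * s ^ 2 := by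
    simp only [D]; ring
  have b8 : η * (D / 2) * s ^ 2 ≤ η * (D / 2) * (2 * (c * Q)) := by
    have : s ^ 2 ≤ 2 * (c * Q) := by linarith
    gcongr
  have b9 : η * (D / 2) * (2 * (c * Q)) = (r - r') * Q := by
    simp only [η]; field_simp
  nlinarith

end Energy

/-! ### Decay estimates along trajectories. -/

section Trajectories

/-- Using `c c₂ ≤ (1 + c c₂)²` avoids a square root in the constant. -/
theorem le_exp_of_energy_decay {c c₂ a₀ b₀ a b Q₀ Q r t : ℝ} (hc : 0 < c) (hc₂ : 0 < c₂)
    (ha₀ : 0 ≤ a₀) (hb₀ : 0 ≤ b₀)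
    (h1 : Real.exp (2 * r * t) * Q ≤ Q₀) (h2 : Q₀ ≤ c₂ * (a₀ ^ 2 + b₀ ^ 2))
    (h3 : a ^ 2 + b ^ 2 ≤ c * Q) :
    a ≤ (1 + c * c₂) * (a₀ + b₀) * Real.exp (-r * t) ∧
      b ≤ (1 + c * c₂) * (a₀ + b₀) * Real.exp (-r * t) := by
  have h4 : a₀ ^ 2 + b₀ ^ 2 ≤ (a₀ + b₀) ^ 2 := by nlinarith
  have h5 : Q ≤ Real.exp (-r * t) ^ 2 * Q₀ := by
    have e : Real.exp (-r * t) ^ 2 * Real.exp (2 * r * t) = 1 := by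
      rw [← Real.exp_nat_mul, ← Real.exp_add, Real.exp_eq_one_iff]; push_cast; ring
    calc Q = Real.exp (-r * t) ^ 2 * (Real.exp (2 * r * t) * Q) := by
          rw [← mul_assoc, e, one_mul]
      _ ≤ _ := by gcongr
  have h6 : a ^ 2 + b ^ 2 ≤ ((1 + c * c₂) * (a₀ + b₀) * Real.exp (-r * t)) ^ 2 := by
    have h7 : c * Q ≤ c * (Real.exp (-r * t) ^ 2 * (c₂ * (a₀ + b₀) ^ 2)) := by
      gcongr
      exact h5.trans (by gcongr; exact h2.trans (by gcongr))
    have h8 : c * c₂ ≤ (1 + c * c₂) ^ 2 := by nlinarith [mul_pos hc hc₂]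
    calc _ ≤ c * (Real.exp (-r * t) ^ 2 * (c₂ * (a₀ + b₀) ^ 2)) := h3.trans h7
      _ = c * c₂ * ((a₀ + b₀) * Real.exp (-r * t)) ^ 2 := by ring
      _ ≤ (1 + c * c₂) ^ 2 * ((a₀ + b₀) * Real.exp (-r * t)) ^ 2 := by gcongr
      _ = _ := by ring
  have h9 : 0 ≤ (1 + c * c₂) * (a₀ + b₀) * Real.exp (-r * t) := by positivity
  exact ⟨le_of_sq_le_sq (by nlinarith [sq_nonneg b]) h9,
    le_of_sq_le_sq (by nlinarith [sq_nonneg a]) h9⟩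

theorem antitoneOn_exp_mul_of_deriv_le {Q : ℝ → ℝ} {T r : ℝ} (hQc : ContinuousOn Q (Icc 0 T))
    (hQ : ∀ s ∈ Ioo 0 T, ∃ Q', HasDerivAt Q Q' s ∧ Q' ≤ -(2 * r) * Q s) :
    AntitoneOn (fun s => Real.exp (2 * r * s) * Q s) (Icc 0 T) := by
  have hexp : ∀ s, HasDerivAt (fun s => Real.exp (2 * r * s))
      (Real.exp (2 * r * s) * (2 * r)) s := fun s => by
    simpa using ((hasDerivAt_id s).const_mul (2 * r)).exp
  refine antitoneOn_of_deriv_nonpos (convex_Icc 0 T) ?_ ?_ ?_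
  · exact (Continuous.continuousOn (by fun_prop)).mul hQc
  · rw [interior_Icc]
    intro s hs
    obtain ⟨Q', hQ', -⟩ := hQ s hs
    exact ((hexp s).mul hQ').differentiableAt.differentiableWithinAt
  · rw [interior_Icc]
    intro s hs
    obtain ⟨Q', hQ', hle⟩ := hQ s hs
    have hd : HasDerivAt (fun s => Real.exp (2 * r * s) * Q s)
        (Real.exp (2 * r * s) * (2 * r) * Q s + Real.exp (2 * r * s) * Q') s :=
      (hexp s).mul hQ'
    rw [hd.deriv]
    have := Real.exp_pos (2 * r * s)
    nlinarith

variable {E : Type*} [NormedAddCommGroup E] [InnerProductSpace ℝ E]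

theorem hasDerivAt_heavyBallEnergy {H : E →L[ℝ] E}
    (hH : ∀ u w, inner ℝ (H u) w = inner ℝ u (H w)) {γ r t : ℝ} {q v : ℝ → E} {q' v' : E}
    (hq : HasDerivAt q q' t) (hv : HasDerivAt v v' t) :
    HasDerivAt (fun s => heavyBallEnergy H γ r (q s) (v s))
      (2 * (inner ℝ (v t + r • q t) (v' + r • q')
        + inner ℝ (H (q t) - (γ * r - r ^ 2) • q t) q')) t := by
  have h1 := (hv.add (hq.const_smul r)).norm_sq
  have hHq : HasDerivAt (fun s => H (q s)) (H q') t := H.hasFDerivAt.comp_hasDerivAt t hq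
  have h2 := hHq.inner ℝ hq
  have h3 := hq.norm_sq.const_mul (γ * r - r ^ 2)
  refine ((h1.add (h2.sub h3)).congr_deriv ?_)
  have h4 : inner ℝ (H q') (q t) = inner ℝ (H (q t)) q' := by rw [hH, real_inner_comm]
  rw [h4]
  simp only [inner_sub_left, inner_smul_left, conj_trivial, Pi.add_apply, Pi.smul_apply]
  ring

/-- Exponential decay of the normal coordinate and of the velocity, as long as the trajectory
remains near the base point. -/
theorem exists_heavyBall_decay {g q : E → E} {a : E} {H : E →L[ℝ] E} {N : Submodule ℝ E}
    [N.HasOrthogonalProjection] {γ r r' μ : ℝ}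
    (hr : 2 * r ≤ γ) (hr0 : 0 ≤ r) (hr' : r' < r) (hμ : γ * r - r ^ 2 < μ)
    (hH : ∀ u w, inner ℝ (H u) w = inner ℝ u (H w)) (hHN : ∀ u, H u ∈ N)
    (hHμ : ∀ q ∈ N, μ * ‖q‖ ^ 2 ≤ inner ℝ (H q) q)
    (hq : ContDiff ℝ 1 q) (hqN : ∀ x, q x ∈ N) (hqd : HasFDerivAt q N.starProjection a)
    (hgq : ∀ η > 0, ∀ᶠ x in 𝓝 a, ‖g x - H (q x)‖ ≤ η * ‖q x‖) :
    ∃ M > 0, ∃ R > 0, ∀ T : ℝ, ∀ x v : ℝ → E,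
      ContinuousOn x (Icc 0 T) → ContinuousOn v (Icc 0 T) →
      (∀ t ∈ Ico 0 T, x t ∈ Metric.ball a R ∧ HasDerivWithinAt x (v t) (Ici 0) t ∧
        HasDerivWithinAt v (-(γ • v t) - g (x t)) (Ici 0) t) →
      ∀ t ∈ Icc 0 T, ‖q (x t)‖ ≤ M * (‖q (x 0)‖ + ‖v 0‖) * Real.exp (-r' * t) ∧
        ‖v t‖ ≤ M * (‖q (x 0)‖ + ‖v 0‖) * Real.exp (-r' * t) := by
  obtain ⟨η, hη, hdis⟩ := exists_perturbed_heavyBallEnergy_dissipation hr hr0 hr' hμ hHN hHμ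
  set P := N.starProjection
  have hcont : Continuous (fderiv ℝ q) := hq.continuous_fderiv one_ne_zero
  have hfd : fderiv ℝ q a = P := hqd.fderiv
  have hev : ∀ᶠ x in 𝓝 a, ‖fderiv ℝ q x - P‖ < η := by
    have h1 : Tendsto (fun x => ‖fderiv ℝ q x - P‖) (𝓝 a) (𝓝 0) := by
      have : Continuous fun x => ‖fderiv ℝ q x - P‖ := (hcont.sub continuous_const).norm
      simpa [hfd] using this.tendsto a
    exact h1.eventually (gt_mem_nhds hη)
  obtain ⟨R, hR, hball⟩ := Metric.eventually_nhds_iff_ball.1 (hev.and (hgq η hη))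
  set α := μ - (γ * r - r ^ 2)
  have hα : 0 < α := sub_pos.2 hμ
  set c := 2 + (2 * r ^ 2 + 1) / α
  set c₂ := 2 + 2 * r ^ 2 + ‖H‖ + |γ * r - r ^ 2|
  have hc : 0 < c := by positivity
  have hc₂ : 0 < c₂ := by positivity
  refine ⟨1 + c * c₂, by positivity, R, hR, fun T x v hx hv hode t ht => ?_⟩
  set Q : ℝ → ℝ := fun s => heavyBallEnergy H γ r (q (x s)) (v s)
  have hQ : ∀ s ∈ Ioo 0 T, ∃ Q', HasDerivAt Q Q' s ∧ Q' ≤ -(2 * r') * Q s := by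
    intro s hs
    obtain ⟨hxR, hxd, hvd⟩ := hode s ⟨hs.1.le, hs.2⟩
    obtain ⟨hb1, hb2⟩ := hball _ hxR
    have hxd := hxd.hasDerivAt (Ici_mem_nhds hs.1)
    have hvd := hvd.hasDerivAt (Ici_mem_nhds hs.1)
    have hqd : HasDerivAt (fun s => q (x s)) (fderiv ℝ q (x s) (v s)) s :=
      ((hq.differentiable one_ne_zero (x s)).hasFDerivAt).comp_hasDerivAt s hxd
    refine ⟨_, hasDerivAt_heavyBallEnergy hH hqd hvd, ?_⟩
    -- The errors are `(Dq(x) - P) v` and `-(g(x) - H q)`, both small on the ball.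
    have h1 := hdis (q (x s)) (hqN _) (v s) (fderiv ℝ q (x s) (v s) - P (v s))
      (-(g (x s) - H (q (x s)))) ?_ (by rw [norm_neg]; exact hb2)
    · have e1 : P (v s) + (fderiv ℝ q (x s) (v s) - P (v s)) = fderiv ℝ q (x s) (v s) := by abel
      have e2 : -(γ • v s) - H (q (x s)) + -(g (x s) - H (q (x s)))
          = -(γ • v s) - g (x s) := by abel
      rw [e1, e2] at h1
      simp only [Q]
      linarith
    · exact ((fderiv ℝ q (x s) - P).le_opNorm (v s)).trans (by gcongr)
  have hqx : ContinuousOn (fun s => q (x s)) (Icc 0 T) := hq.continuous.comp_continuousOn hx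
  have hQc : ContinuousOn Q (Icc 0 T) := by
    simp only [Q, heavyBallEnergy]
    have h1 : ContinuousOn (fun s => H (q (x s))) (Icc 0 T) := H.continuous.comp_continuousOn hqx
    exact ((hv.add (hqx.const_smul r)).norm.pow 2).add
      ((h1.inner hqx).sub (continuousOn_const.mul (hqx.norm.pow 2)))
  have hanti : AntitoneOn (fun s => Real.exp (2 * r' * s) * Q s) (Icc 0 T) :=
    antitoneOn_exp_mul_of_deriv_le hQc hQ
  have hT : (0 : ℝ) ≤ T := ht.1.trans ht.2
  have h1 : Real.exp (2 * r' * t) * Q t ≤ Q 0 := by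
    simpa using hanti (left_mem_Icc.2 hT) ht ht.1
  have h2 : Q 0 ≤ c₂ * (‖q (x 0)‖ ^ 2 + ‖v 0‖ ^ 2) := heavyBallEnergy_le _ _
  have h3 : ‖q (x t)‖ ^ 2 + ‖v t‖ ^ 2 ≤ c * Q t :=
    le_heavyBallEnergy hα (by simp [α]) (hHμ _ (hqN _)) _
  exact le_exp_of_energy_decay hc hc₂ (norm_nonneg _) (norm_nonneg _) h1 h2 h3

/-- A curve with exponentially decaying velocity has exponentially small increments. -/
theorem norm_sub_le_of_norm_deriv_le_exp {x v : ℝ → E} {T D r : ℝ} (hr : 0 < r) (hD : 0 ≤ D)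
    (hx : ContinuousOn x (Icc 0 T))
    (hxd : ∀ t ∈ Ico 0 T, HasDerivWithinAt x (v t) (Ici 0) t)
    (hv : ∀ t ∈ Icc 0 T, ‖v t‖ ≤ D * Real.exp (-r * t)) {s t : ℝ} (hs : 0 ≤ s) (hst : s ≤ t)
    (ht : t ≤ T) : ‖x t - x s‖ ≤ D / r * Real.exp (-r * s) := by
  have hsub : Icc s T ⊆ Icc 0 T := Icc_subset_Icc_left hs
  have h := image_norm_le_of_norm_deriv_right_le_deriv_boundary (f := fun t => x t - x s) (a := s)
    (b := T) (f' := v) (B := fun t => D / r * (Real.exp (-r * s) - Real.exp (-r * t)))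
    (B' := fun t => D * Real.exp (-r * t)) ((hx.mono hsub).sub continuousOn_const)
    (fun u hu => ?_) (by simp) (fun u => ?_)
    (fun u hu => hv u ⟨hs.trans hu.1, hu.2.le⟩) ⟨hst, ht⟩
  · refine h.trans ?_
    have : 0 ≤ D / r := by positivity
    have := Real.exp_pos (-r * t)
    gcongr
    linarith
  · have h0 := (hxd u ⟨hs.trans hu.1, hu.2⟩).sub_const (x s)
    exact h0.mono (Ici_subset_Ici.2 (hs.trans hu.1))
  · have h1 : HasDerivAt (fun t => Real.exp (-r * t)) (Real.exp (-r * u) * -r) u := by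
      simpa using ((hasDerivAt_id u).const_mul (-r)).exp
    have h2 := ((hasDerivAt_const u (Real.exp (-r * s))).sub h1).const_mul (D / r)
    refine h2.congr_deriv ?_
    field_simp
    ring

end Trajectories

/-! ### Global solutions by cutting off the vector field. -/

section GlobalExistence

variable {F : Type*} [NormedAddCommGroup F] [NormedSpace ℝ F] [CompleteSpace F]

/-- A bounded Lipschitz vector field has solutions on `[0, ∞)`. -/
theorem exists_forall_hasDerivWithinAt_of_lipschitzWith_of_bounded {X : F → F} {K L : NNReal}
    (hK : LipschitzWith K X) (hL : ∀ z, ‖X z‖ ≤ L) (z₀ : F) :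
    ∃ z : ℝ → F, z 0 = z₀ ∧ ∀ t, 0 ≤ t → HasDerivWithinAt z (X (z t)) (Ici 0) t := by
  have hloc : ∀ n : ℕ, ∃ α : ℝ → F, α 0 = z₀ ∧
      ∀ t ∈ Icc (0 : ℝ) n, HasDerivWithinAt α (X (α t)) (Icc 0 n) t := by
    intro n
    have hPL : IsPicardLindelof (fun _ : ℝ => X)
        (⟨0, left_mem_Icc.2 n.cast_nonneg⟩ : Icc (0 : ℝ) n) z₀ (L * n) 0 L K :=
      { lipschitzOnWith := fun _ _ => hK.lipschitzOnWith
        continuousOn := fun _ _ => continuousOn_const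
        norm_le := fun _ _ z _ => hL z
        mul_max_le := by simp }
    exact hPL.exists_eq_forall_mem_Icc_hasDerivWithinAt₀
  choose α hα0 hα using hloc
  have hαc : ∀ n, ContinuousOn (α n) (Icc 0 n) := fun n t ht => (hα n t ht).continuousWithinAt
  have hαd : ∀ n : ℕ, ∀ t ∈ Ico (0 : ℝ) n, HasDerivWithinAt (α n) (X (α n t)) (Ici t) t := by
    intro n t ht
    exact (hα n t ⟨ht.1, ht.2.le⟩).mono_of_mem_nhdsWithin
      (mem_of_superset (Icc_mem_nhdsGE ht.2) (Icc_subset_Icc_left ht.1))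
  have heq : ∀ m n : ℕ, m ≤ n → EqOn (α m) (α n) (Icc 0 m) := by
    intro m n hmn
    have hmn' : (m : ℝ) ≤ n := by exact_mod_cast hmn
    exact ODE_solution_unique (fun _ => hK) (hαc m) (hαd m)
      ((hαc n).mono (Icc_subset_Icc_right hmn'))
      (fun t ht => hαd n t ⟨ht.1, ht.2.trans_le hmn'⟩) (by rw [hα0, hα0])
  have heq' : ∀ (m n : ℕ) (t : ℝ), 0 ≤ t → t ≤ m → t ≤ n → α m t = α n t := by
    intro m n t h0 hm hn
    rcases le_total m n with h | h
    · exact heq m n h ⟨h0, hm⟩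
    · exact (heq n m h ⟨h0, hn⟩).symm
  refine ⟨fun t => α (⌈t⌉₊) t, by simp [hα0], fun t ht => ?_⟩
  -- The extra unit puts `t` strictly before the end of `[0, n]`.
  set n := ⌈t⌉₊ + 1
  have htn : t < n := (Nat.le_ceil t).trans_lt (by simp [n])
  have hev : (fun s => α (⌈s⌉₊) s) =ᶠ[𝓝[Ici 0] t] α n := by
    filter_upwards [self_mem_nhdsWithin, mem_nhdsWithin_of_mem_nhds (Iio_mem_nhds htn)] with s hs hsn
    exact heq' _ _ s hs (Nat.le_ceil s) (le_of_lt hsn)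
  have hval : α (⌈t⌉₊) t = α n t := heq' _ _ t ht (Nat.le_ceil t) htn.le
  have hd : HasDerivWithinAt (α n) (X (α n t)) (Ici 0) t :=
    (hα n t ⟨ht, htn.le⟩).mono_of_mem_nhdsWithin
      (by filter_upwards [self_mem_nhdsWithin, mem_nhdsWithin_of_mem_nhds (Iio_mem_nhds htn)]
            with s hs hsn using ⟨hs, le_of_lt hsn⟩)
  have := hd.congr_of_eventuallyEq hev hval
  simpa only [hval] using this

/-- A `C¹` vector field on a finite-dimensional space coincides on a ball with a vector field with
solutions on `[0, ∞)`. -/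
theorem exists_forall_hasDerivWithinAt_of_mem_ball [FiniteDimensional ℝ F] {X : F → F}
    (hX : ContDiff ℝ 1 X) (c : F) {R : ℝ} (hR : 0 < R) (z₀ : F) :
    ∃ z : ℝ → F, z 0 = z₀ ∧ ContinuousOn z (Ici 0) ∧
      ∀ t, 0 ≤ t → z t ∈ Metric.ball c R → HasDerivWithinAt z (X (z t)) (Ici 0) t := by
  let χ : ContDiffBump c := ⟨R, R + 1, hR, by linarith⟩
  set Y : F → F := fun z => χ z • X z
  have hYc : ContDiff ℝ 1 Y := χ.contDiff.smul hX
  have hYs : HasCompactSupport Y := χ.hasCompactSupport.smul_right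
  obtain ⟨K, hK⟩ := hYc.lipschitzWith_of_hasCompactSupport hYs one_ne_zero
  obtain ⟨L, hL⟩ := hYs.exists_bound_of_continuous hYc.continuous
  have hL' : ∀ z, ‖Y z‖ ≤ L.toNNReal := fun z => (hL z).trans (Real.le_coe_toNNReal L)
  obtain ⟨z, hz0, hz⟩ := exists_forall_hasDerivWithinAt_of_lipschitzWith_of_bounded hK hL' z₀
  refine ⟨z, hz0, fun t ht => (hz t ht).continuousWithinAt, fun t ht htR => ?_⟩
  have h1 : χ (z t) = 1 := χ.one_of_mem_closedBall (Metric.ball_subset_closedBall htR)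
  have h2 := hz t ht
  simpa only [Y, h1, one_smul] using h2

end GlobalExistence

/-! ### Trapping near the base point and convergence. -/

section Convergence

/-- A curve with exponentially small increments converges exponentially. -/
theorem exists_tendsto_of_norm_sub_le_exp {E : Type*} [NormedAddCommGroup E]
    [CompleteSpace E] {x : ℝ → E} {D r : ℝ} (hr : 0 < r)
    (h : ∀ s t, 0 ≤ s → s ≤ t → ‖x t - x s‖ ≤ D * Real.exp (-r * s)) :
    ∃ x', Tendsto x atTop (𝓝 x') ∧ ∀ t, 0 ≤ t → ‖x t - x'‖ ≤ D * Real.exp (-r * t) := by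
  have hlim : Tendsto (fun t => D * Real.exp (-r * t)) atTop (𝓝 0) := by
    have h1 : Tendsto (fun t : ℝ => -r * t) atTop atBot :=
      tendsto_id.const_mul_atTop_of_neg (neg_neg_of_pos hr)
    simpa using (Real.tendsto_exp_atBot.comp h1).const_mul D
  have hc : Cauchy (map x atTop) := by
    refine Metric.cauchy_iff.2 ⟨inferInstance, fun ε hε => ?_⟩
    obtain ⟨s, hs0, hs⟩ := ((eventually_ge_atTop (0 : ℝ)).and
      (hlim.eventually (gt_mem_nhds (half_pos hε)))).exists
    refine ⟨x '' Ici s, image_mem_map (Ici_mem_atTop s), ?_⟩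
    rintro _ ⟨t, ht, rfl⟩ _ ⟨u, hu, rfl⟩
    have h1 := h s t hs0 ht
    have h2 := h s u hs0 hu
    calc dist (x t) (x u) ≤ dist (x t) (x s) + dist (x u) (x s) := dist_triangle_right _ _ _
      _ < ε := by rw [dist_eq_norm, dist_eq_norm]; linarith
  obtain ⟨x', hx'⟩ := CompleteSpace.complete hc
  have hx' : Tendsto x atTop (𝓝 x') := hx'
  refine ⟨x', hx', fun t ht => ?_⟩
  have h1 : Tendsto (fun s => ‖x s - x t‖) atTop (𝓝 ‖x' - x t‖) := (hx'.sub_const _).norm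
  rw [norm_sub_rev]
  refine le_of_tendsto h1 ?_
  filter_upwards [eventually_ge_atTop t] with s hs using h t s ht hs

variable {E : Type*} [NormedAddCommGroup E] [InnerProductSpace ℝ E]

/-- Trajectories with small initial data remain near the base point and converge exponentially to
a zero of the normal coordinate. -/
theorem exists_heavyBall_convergence [CompleteSpace E] {g q : E → E} {a : E} {H : E →L[ℝ] E}
    {N : Submodule ℝ E} [N.HasOrthogonalProjection] {γ r r' μ : ℝ}
    (hr : 2 * r ≤ γ) (hr0 : 0 < r') (hr' : r' < r) (hμ : γ * r - r ^ 2 < μ)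
    (hH : ∀ u w, inner ℝ (H u) w = inner ℝ u (H w)) (hHN : ∀ u, H u ∈ N)
    (hHμ : ∀ q ∈ N, μ * ‖q‖ ^ 2 ≤ inner ℝ (H q) q)
    (hq : ContDiff ℝ 1 q) (hqN : ∀ x, q x ∈ N) (hqd : HasFDerivAt q N.starProjection a)
    (hgq : ∀ η > 0, ∀ᶠ x in 𝓝 a, ‖g x - H (q x)‖ ≤ η * ‖q x‖) :
    ∃ M > 0, ∃ R₀ > 0, ∀ R ≤ R₀, ∀ x v : ℝ → E,
      ContinuousOn x (Ici 0) → ContinuousOn v (Ici 0) →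
      (∀ t, 0 ≤ t → ‖x t - a‖ < R → ‖v t‖ < R → HasDerivWithinAt x (v t) (Ici 0) t ∧
        HasDerivWithinAt v (-(γ • v t) - g (x t)) (Ici 0) t) →
      ‖x 0 - a‖ + M * (‖q (x 0)‖ + ‖v 0‖) < R →
      (∀ t, 0 ≤ t → ‖x t - a‖ < R ∧ ‖v t‖ < R) ∧
      ∃ x', q x' = 0 ∧ Tendsto x atTop (𝓝 x') ∧ ∀ t, 0 ≤ t →
        ‖x t - x'‖ ≤ M * (‖q (x 0)‖ + ‖v 0‖) * Real.exp (-r' * t) := by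
  obtain ⟨M, hM, R₀, hR₀, hdec⟩ :=
    exists_heavyBall_decay hr (hr0.trans hr').le hr' hμ hH hHN hHμ hq hqN hqd hgq
  -- `M` bounds the velocity and `M / r'`, from integrating it, the displacement.
  refine ⟨M + M / r', by positivity, R₀, hR₀, fun R hR x v hx hv hode hinit => ?_⟩
  set s₀ := ‖q (x 0)‖ + ‖v 0‖
  have hs₀ : 0 ≤ s₀ := by positivity
  have hMs : 0 ≤ M * s₀ := by positivity
  have hMr : 0 ≤ M / r' * s₀ := by positivity
  -- Continuation: bounds on `[0, T)` persist strictly at `T`, which excludes a first exit time.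
  have hstep : ∀ T, 0 ≤ T → (∀ t ∈ Ico 0 T, ‖x t - a‖ < R ∧ ‖v t‖ < R) →
      (∀ t ∈ Icc 0 T, ‖q (x t)‖ ≤ M * s₀ * Real.exp (-r' * t)) ∧
      (∀ s t, 0 ≤ s → s ≤ t → t ≤ T → ‖x t - x s‖ ≤ M * s₀ / r' * Real.exp (-r' * s)) ∧
      ‖x T - a‖ < R ∧ ‖v T‖ < R := by
    intro T hT hgood
    have hode' : ∀ t ∈ Ico 0 T, HasDerivWithinAt x (v t) (Ici 0) t ∧
        HasDerivWithinAt v (-(γ • v t) - g (x t)) (Ici 0) t :=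
      fun t ht => hode t ht.1 (hgood t ht).1 (hgood t ht).2
    have hx' := hx.mono (Icc_subset_Ici_self : Icc 0 T ⊆ Ici 0)
    have hd := hdec T x v hx' (hv.mono Icc_subset_Ici_self) fun t ht =>
      ⟨by rw [mem_ball_iff_norm]; exact (hgood t ht).1.trans_le hR, hode' t ht⟩
    have hinc : ∀ s t, 0 ≤ s → s ≤ t → t ≤ T →
        ‖x t - x s‖ ≤ M * s₀ / r' * Real.exp (-r' * s) := fun s t hs hst ht =>
      norm_sub_le_of_norm_deriv_le_exp hr0 hMs hx' (fun u hu => (hode' u hu).1)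
        (fun u hu => (hd u hu).2) hs hst ht
    refine ⟨fun t ht => (hd t ht).1, hinc, ?_, ?_⟩
    · have h1 := hinc 0 T le_rfl hT le_rfl
      rw [mul_zero, Real.exp_zero, mul_one] at h1
      have h2 : ‖x T - a‖ ≤ ‖x T - x 0‖ + ‖x 0 - a‖ := norm_sub_le_norm_sub_add_norm_sub _ _ _
      have h3 : M * s₀ / r' = M / r' * s₀ := by ring
      nlinarith
    · have h1 := (hd T ⟨hT, le_rfl⟩).2
      have h2 : Real.exp (-r' * T) ≤ 1 := Real.exp_le_one_iff.2 (by nlinarith)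
      have h3 : M * s₀ * Real.exp (-r' * T) ≤ M * s₀ := mul_le_of_le_one_right hMs h2
      nlinarith [norm_nonneg (x 0 - a)]
  have hgood : ∀ t, 0 ≤ t → ‖x t - a‖ < R ∧ ‖v t‖ < R := by
    by_contra! hbad
    set φ : ℝ → ℝ := fun t => max ‖x t - a‖ ‖v t‖
    have hφ : ContinuousOn φ (Ici 0) := (hx.sub continuousOn_const).norm.sup hv.norm
    set A := Ici (0 : ℝ) ∩ φ ⁻¹' Ici R
    have hA : IsClosed A := hφ.preimage_isClosed_of_isClosed isClosed_Ici isClosed_Ici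
    have hAne : A.Nonempty := by
      obtain ⟨t, ht, hbt⟩ := hbad
      refine ⟨t, ht, ?_⟩
      by_cases h : ‖x t - a‖ < R
      · exact (hbt h).trans (le_max_right _ _)
      · exact (not_lt.1 h).trans (le_max_left _ _)
    have hAb : BddBelow A := ⟨0, fun t ht => ht.1⟩
    have hT := hA.csInf_mem hAne hAb
    have h1 := (hstep (sInf A) hT.1 fun t ht => ?_).2.2
    · exact absurd hT.2 (not_le.2 (max_lt h1.1 h1.2))
    · have h2 : t ∉ A := notMem_of_lt_csInf ht.2 hAb
      have h3 : φ t < R := not_le.1 fun h => h2 ⟨ht.1, h⟩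
      exact max_lt_iff.1 h3
  refine ⟨hgood, ?_⟩
  have hall := fun T hT => hstep T hT fun t ht => hgood t ht.1
  obtain ⟨x', hx', hrate⟩ := exists_tendsto_of_norm_sub_le_exp hr0
    fun s t hs hst => (hall t (hs.trans hst)).2.1 s t hs hst le_rfl
  refine ⟨x', ?_, hx', fun t ht => (hrate t ht).trans ?_⟩
  · have h1 : Tendsto (fun t => q (x t)) atTop (𝓝 (q x')) := (hq.continuous.tendsto x').comp hx'
    have h2 : Tendsto (fun t => q (x t)) atTop (𝓝 0) := by
      have h3 : Tendsto (fun t : ℝ => -r' * t) atTop atBot :=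
        tendsto_id.const_mul_atTop_of_neg (neg_neg_of_pos hr0)
      have h4 : Tendsto (fun t => M * s₀ * Real.exp (-r' * t)) atTop (𝓝 0) := by
        simpa using (Real.tendsto_exp_atBot.comp h3).const_mul (M * s₀)
      refine squeeze_zero_norm' ?_ h4
      filter_upwards [eventually_ge_atTop 0] with t ht using (hall t ht).1 t ⟨ht, le_rfl⟩
    exact tendsto_nhds_unique h1 h2
  · gcongr
    have : M * s₀ / r' = M / r' * s₀ := by ring
    rw [this, add_mul]
    linarith

end Convergence

/-! ### The rate as a function of the damping. -/

theorem heavyBallRate_pos {γ μ : ℝ} (hγ : 0 < γ) (hμ : 0 < μ) : 0 < heavyBallRate γ μ := by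
  have h : √(max 0 (γ ^ 2 - 4 * μ)) < γ := by
    rw [Real.sqrt_lt' hγ]
    exact max_lt (by positivity) (by linarith)
  unfold heavyBallRate
  linarith

theorem two_mul_heavyBallRate_le (γ μ : ℝ) : 2 * heavyBallRate γ μ ≤ γ := by
  unfold heavyBallRate
  linarith [Real.sqrt_nonneg (max 0 (γ ^ 2 - 4 * μ))]

/-- Here `γ r - r² = γ²/4 - (γ/2 - r)²`, and `r < ρ_γ` makes `(γ/2 - r)²` exceed `γ²/4 - μ`. -/
theorem mul_sub_sq_lt_of_lt_heavyBallRate {γ μ r : ℝ} (hr : r < heavyBallRate γ μ) :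
    γ * r - r ^ 2 < μ := by
  have h0 := Real.sqrt_nonneg (max 0 (γ ^ 2 - 4 * μ))
  have h1 := Real.sq_sqrt (le_max_left 0 (γ ^ 2 - 4 * μ))
  have h2 := le_max_right 0 (γ ^ 2 - 4 * μ)
  unfold heavyBallRate at hr
  nlinarith

theorem heavyBallRate_two_mul_sqrt {μ : ℝ} (hμ : 0 < μ) : heavyBallRate (2 * √μ) μ = √μ := by
  have h : (2 * √μ) ^ 2 - 4 * μ = 0 := by rw [mul_pow, Real.sq_sqrt hμ.le]; ring
  rw [heavyBallRate, h, max_self, Real.sqrt_zero]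
  ring

theorem heavyBallRate_lt_sqrt {γ μ : ℝ} (hγ : 0 < γ) (hμ : 0 < μ) (hne : γ ≠ 2 * √μ) :
    heavyBallRate γ μ < √μ := by
  have hs := Real.sqrt_pos.2 hμ
  have hs2 := Real.sq_sqrt hμ.le
  have h0 := Real.sqrt_nonneg (max 0 (γ ^ 2 - 4 * μ))
  unfold heavyBallRate
  rcases lt_or_gt_of_ne hne with h | h
  · linarith
  · have h1 : γ - 2 * √μ < √(max 0 (γ ^ 2 - 4 * μ)) := by
      refine Real.lt_sqrt_of_sq_lt (lt_of_lt_of_le ?_ (le_max_right _ _))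
      nlinarith
    linarith

theorem HasLocalExpRate.mono {d : ℕ} {f : EuclideanSpace ℝ (Fin d) → ℝ}
    {xs : EuclideanSpace ℝ (Fin d)} {γ r r' : ℝ} (h : HasLocalExpRate f xs γ r') (hr : r ≤ r') :
    HasLocalExpRate f xs γ r := by
  obtain ⟨C, hC, h⟩ := h
  refine ⟨C, hC, fun V hV => ?_⟩
  obtain ⟨W, hW, hxW, h⟩ := h V hV
  refine ⟨W, hW, hxW, fun x₀ v₀ h₀ => ⟨(h x₀ v₀ h₀).1, fun x v hxv hx hv => ?_⟩⟩
  obtain ⟨x', hx', hV', hlim, hrate⟩ := (h x₀ v₀ h₀).2 x v hxv hx hv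
  refine ⟨x', hx', hV', hlim, fun t ht => (hrate t ht).trans ?_⟩
  gcongr

theorem contDiff_heavyBall_field {E : Type*} [NormedAddCommGroup E] [NormedSpace ℝ E] {g : E → E}
    (hg : ContDiff ℝ 1 g) (γ : ℝ) :
    ContDiff ℝ 1 fun z : E × E => (z.2, -(γ • z.2) - g z.1) := by
  have h1 : ContDiff ℝ 1 fun z : E × E => g z.1 := hg.comp contDiff_fst
  fun_prop

/-! ### Assembly of the convergence theorem. -/

section Rate

variable {d : ℕ} {f : EuclideanSpace ℝ (Fin d) → ℝ} {xs : EuclideanSpace ℝ (Fin d)}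

/-- Every rate in `(0, ρ_γ)` is attained. -/
theorem LocalPL.hasLocalExpRate_of_lt (hPL : LocalPL f xs) (hf : ContDiff ℝ 2 f)
    (hmin : IsLocalMin f xs) (hnonconst : ¬ ∀ᶠ x in 𝓝 xs, f x = f xs) {γ r' : ℝ} (hr0 : 0 < r')
    (hr' : r' < heavyBallRate γ (normalMu f xs)) : HasLocalExpRate f xs γ r' := by
  -- `r < ρ_γ` gives coercivity; the gap `r - r'` absorbs the nonlinear errors.
  obtain ⟨r, hr'r, hrρ⟩ := exists_between hr'
  obtain ⟨q, hq, hq0, hqd, hqP, hmem, hgq⟩ := hPL.exists_normal_coordinate hf hmin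
  obtain ⟨-, -, hHμ⟩ := hPL.normalMu_spec hf hmin hnonconst
  have hH : ∀ u w, inner ℝ (hessian f xs u) w = inner ℝ u (hessian f xs w) :=
    inner_fderiv_gradient_comm hf xs
  obtain ⟨M, hM, R₀, hR₀, hconv⟩ := exists_heavyBall_convergence (γ := γ)
    (by linarith [two_mul_heavyBallRate_le γ (normalMu f xs)]) hr0 hr'r
    (mul_sub_sq_lt_of_lt_heavyBallRate hrρ) hH
    (fun u => Submodule.starProjection_eq_self_iff.1
      (starProjection_ker_orthogonal_apply_map hH rfl u)) hHμ hq
    (fun x => Submodule.starProjection_eq_self_iff.1 (hqP x)) hqd.hasFDerivAt hgq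
  have hlip : ∀ᶠ p in 𝓝 (xs, xs), ‖q p.1 - q p.2‖ ≤ 2 * ‖p.1 - p.2‖ := by
    filter_upwards [hqd.isLittleO.def one_pos] with p hp
    have h1 := (hessian f xs).kerᗮ.norm_starProjection_apply_le (p.1 - p.2)
    have h2 := norm_le_norm_sub_add (q p.1 - q p.2)
      ((hessian f xs).kerᗮ.starProjection (p.1 - p.2))
    linarith
  rw [nhds_prod_eq] at hlip
  obtain ⟨R₁, hR₁, hball₁⟩ := (Metric.nhds_basis_ball (x := xs)).prod_self.mem_iff.1 hlip
  refine ⟨2 * M, by positivity, fun V hV => ?_⟩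
  obtain ⟨R₂, hR₂, hball₂⟩ := Metric.mem_nhds_iff.1 (inter_mem hV hmem)
  set R := min R₀ (min R₁ R₂)
  have hR : 0 < R := lt_min hR₀ (lt_min hR₁ hR₂)
  have hRR₀ : R ≤ R₀ := min_le_left _ _
  have hRR₁ : R ≤ R₁ := (min_le_right _ _).trans (min_le_left _ _)
  have hRR₂ : R ≤ R₂ := (min_le_right _ _).trans (min_le_right _ _)
  have hqc := hq.continuous
  -- One `M` term keeps the trajectory in the ball; doubling it leaves room for the limit, which is
  -- within one such term of `x 0`.
  refine ⟨{p | ‖p.1 - xs‖ + 2 * M * (‖q p.1‖ + ‖p.2‖) < R}, ?_, by simpa [hq0] using hR,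
    fun x₀ v₀ h₀ => ?_⟩
  · exact isOpen_lt (by fun_prop) continuous_const
  have h₀ : ‖x₀ - xs‖ + 2 * M * (‖q x₀‖ + ‖v₀‖) < R := h₀
  have hMs : 0 ≤ M * (‖q x₀‖ + ‖v₀‖) := by positivity
  have hinit : ‖x₀ - xs‖ + M * (‖q x₀‖ + ‖v₀‖) < R := by linarith
  constructor
  -- The cut-off solution is trapped where the cutoff is inactive, so it solves the original
  -- equation.
  · obtain ⟨z, hz0, hzc, hz⟩ := exists_forall_hasDerivWithinAt_of_mem_ball
      (contDiff_heavyBall_field hf.gradient_one γ) (xs, 0) hR (x₀, v₀)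
    have hode : ∀ t, 0 ≤ t → ‖(z t).1 - xs‖ < R → ‖(z t).2‖ < R →
        HasDerivWithinAt (fun t => (z t).1) (z t).2 (Ici 0) t ∧
        HasDerivWithinAt (fun t => (z t).2) (-(γ • (z t).2) - gradient f (z t).1) (Ici 0) t := by
      intro t ht h1 h2
      have h3 := hz t ht (by
        rw [mem_ball_iff_norm, Prod.norm_def]
        exact max_lt h1 (by simpa using h2))
      exact ⟨(hasFDerivAt_fst (p := z t)).comp_hasDerivWithinAt t h3,
        (hasFDerivAt_snd (p := z t)).comp_hasDerivWithinAt t h3⟩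
    have hgood := (hconv R hRR₀ (fun t => (z t).1) (fun t => (z t).2)
      (continuous_fst.comp_continuousOn hzc) (continuous_snd.comp_continuousOn hzc) hode
      (by simpa [hz0] using hinit)).1
    exact ⟨fun t => (z t).1, fun t => (z t).2,
      fun t ht => hode t ht (hgood t ht).1 (hgood t ht).2, by simp [hz0], by simp [hz0]⟩
  · intro x v hxv hx hv
    subst hx hv
    obtain ⟨-, x', hqx', hlim, hrate⟩ := hconv R hRR₀ x v
      (fun t ht => (hxv t ht).1.continuousWithinAt) (fun t ht => (hxv t ht).2.continuousWithinAt)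
      (fun t ht _ _ => hxv t ht) hinit
    have hr00 := hrate 0 le_rfl
    rw [mul_zero, Real.exp_zero, mul_one] at hr00
    have hx'R : x' ∈ Metric.ball xs R := by
      rw [mem_ball_iff_norm]
      have := norm_sub_le_norm_sub_add_norm_sub x' (x 0) xs
      rw [norm_sub_rev x' (x 0)] at this
      linarith
    have hx0R : x 0 ∈ Metric.ball xs R := by
      rw [mem_ball_iff_norm]
      linarith
    have hx'2 := hball₂ (Metric.ball_subset_ball hRR₂ hx'R)
    refine ⟨x', hx'2.2 hqx', hx'2.1, hlim, fun t ht => (hrate t ht).trans ?_⟩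
    have hl : ‖q (x 0) - q x'‖ ≤ 2 * ‖x 0 - x'‖ :=
      @hball₁ (x 0, x') ⟨Metric.ball_subset_ball hRR₁ hx0R, Metric.ball_subset_ball hRR₁ hx'R⟩
    rw [hqx', sub_zero] at hl
    have h1 : ‖q (x 0)‖ + ‖v 0‖ ≤ 2 * (‖x 0 - x'‖ + ‖v 0‖) := by
      linarith [norm_nonneg (v 0)]
    have h2 : M * (‖q (x 0)‖ + ‖v 0‖) ≤ 2 * M * (‖x 0 - x'‖ + ‖v 0‖) := by
      nlinarith
    gcongr

theorem LocalPL.hasLocalExpRate_sub (hPL : LocalPL f xs) (hf : ContDiff ℝ 2 f)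
    (hmin : IsLocalMin f xs) (hnonconst : ¬ ∀ᶠ x in 𝓝 xs, f x = f xs) {γ ε : ℝ} (hγ : 0 < γ)
    (hε : 0 < ε) : HasLocalExpRate f xs γ (heavyBallRate γ (normalMu f xs) - ε) := by
  have hρ := heavyBallRate_pos hγ (hPL.normalMu_spec hf hmin hnonconst).2.1
  set ρ := heavyBallRate γ (normalMu f xs)
  -- The maximum with `ρ / 2` keeps the rate positive when `ε ≥ ρ`.
  have h := hPL.hasLocalExpRate_of_lt hf hmin hnonconst (γ := γ) (r' := max (ρ - ε) (ρ / 2))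
    (lt_max_of_lt_right (half_pos hρ)) (max_lt (by linarith) (half_lt_self hρ))
  exact h.mono (le_max_left _ _)

end Rate

theorem theorem2p3 {d : ℕ} (f : EuclideanSpace ℝ (Fin d) → ℝ) (xs : EuclideanSpace ℝ (Fin d))
    (hf : ContDiff ℝ 2 f) (hmin : IsLocalMin f xs) (hPL : LocalPL f xs)
    (hnonconst : ¬ ∀ᶠ x in 𝓝 xs, f x = f xs) :
    (IsLeast (normalEigenvalues f xs) (normalMu f xs) ∧ 0 < normalMu f xs) ∧
    (∀ γ : ℝ, 0 < γ → ∀ ε : ℝ, 0 < ε →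
      HasLocalExpRate f xs γ (heavyBallRate γ (normalMu f xs) - ε)) ∧
    (∀ ε : ℝ, 0 < ε →
      HasLocalExpRate f xs (2 * √(normalMu f xs)) (√(normalMu f xs) - ε)) ∧
    heavyBallRate (2 * √(normalMu f xs)) (normalMu f xs) = √(normalMu f xs) ∧
    (∀ γ : ℝ, 0 < γ → γ ≠ 2 * √(normalMu f xs) →
      heavyBallRate γ (normalMu f xs) < √(normalMu f xs)) := by
  obtain ⟨hleast, hμ, -⟩ := hPL.normalMu_spec hf hmin hnonconst
  refine ⟨⟨hleast, hμ⟩, fun γ hγ ε hε => hPL.hasLocalExpRate_sub hf hmin hnonconst hγ hε,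
    fun ε hε => ?_, heavyBallRate_two_mul_sqrt hμ, fun γ hγ hne => heavyBallRate_lt_sqrt hγ hμ hne⟩
  have h := hPL.hasLocalExpRate_sub hf hmin hnonconst (γ := 2 * √(normalMu f xs))
    (by positivity) hε
  rwa [heavyBallRate_two_mul_sqrt hμ] at h
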